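/- Let $\mathbb S^1=\mathbb R/\mathbb Z$ with Lebesgue probability measure $m$, and let $W^{1,1}=W^{1,1}(\mathbb S^1)$ be the space of real $f\in L^1(m)$ with weak derivative $f'\in L^1(m)$, normed by $\|f\|_{W^{1,1}}=\|f\|_{L^1}+\|f'\|_{L^1}$; put $V_s=\{g\in W^{1,1}:\int g\,dm=0\}$. For a $C^3$ map $T:\mathbb S^1\to\mathbb S^1$ with $\inf|T'|>1$ (a uniformly expanding map) let $$L_Tf(x)=\sum_{y:\,T(y)=x}\frac{f(y)}{|T'(y)|}$$ be its transfer (Perron–Frobenius) operator; its degree is its number of sheets as a covering map. For circle maps of the same degree write $$\|T-S\|_{C^2}=\max\bigl\{\sup_x d(T(x),S(x)),\ \|T'-S'\|_\infty,\ \|T''-S''\|_\infty\bigr\}.$$ Let $T_0$ be a $C^3$ uniformly expanding map of $\mathbb S^1$ of degree $n\ge 2$, and let $\lambda_0=\inf|T_0'|>1$ and $L_0=L_{T_0}$. Fix $\lambda_1\in(0,1)$ and $B\ge 0$ such that, for all $f\in W^{1,1}$, $$\|L_0f\|_{L^1}\le\|f\|_{L^1},\qquad \|L_0f\|_{W^{1,1}}\le\lambda_1\|f\|_{W^{1,1}}+B\|f\|_{L^1},$$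 and let $M\in\mathbb N$ be such that $$\lambda_1^M\le\frac1{10\left(\frac{B}{1-\lambda_1}+1\right)},\qquad \|L_0^Mv\|_{L^1}\le\frac1{10B}\|v\|_{W^{1,1}}\quad\text{for all }v\in V_s$$ (the inequalities involving $f$ force $B\ge 1-\lambda_1>0$). Put $$C(T_0)=2n\bigl(\|T_0'\|_\infty+\lambda_0-1\bigr)\left(\frac1{\lambda_0^2}+\frac{\|T_0''\|_\infty}{\lambda_0^3}+\frac1{\lambda_0}\right),$$ and let $0<\delta_*<\lambda_0-1$ satisfy $$C(T_0)\,\delta_*\le\frac{7(1-\lambda_1)^2}{10MB\left(\frac1{1-\lambda_1}+B\right)}.$$ Let $\mathcal S_{T_0}(\delta_*)$ be the set of all $C^3$ uniformly expanding maps $T:\mathbb S^1\to\mathbb S^1$ of degree $n$ with $\|T-T_0\|_{C^2}\le\delta_*$. Then there are constants $C\ge1$ and $\lambda>0$ such that for every sequence $(T_i)_{i\ge0}$ in $\mathcal S_{T_0}(\delta_*)$, all $j,k\in\mathbb N$ (including $k=0$) and all $g\in V_s$, the function $L^{(j,j+k-1)}g:=L_{T_{j+k-1}}\circ\cdots\circ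 L_{T_{j+1}}\circ L_{T_j}\,g$ lies in $W^{1,1}$ and $$\|L^{(j,j+k-1)}g\|_{W^{1,1}}\le C\,e^{-\lambda k}\,\|g\|_{W^{1,1}}.$$ -/

import Mathlib

open MeasureTheory
open scoped ContDiff

namespace CircleMaps

/-- The circle `ℝ / ℤ`, with its normalized Lebesgue measure `volume`. -/
abbrev S1 : Type := UnitAddCircle

/-- The representative in `[-1/2, 1/2)` of a point of the circle: the local coordinate at `0`. -/
noncomputable def coord (x : S1) : ℝ := (AddCircle.equivIco (1 : ℝ) (-1 / 2) x : ℝ)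

/-- The derivative of a real function on the circle. -/
noncomputable def circleDeriv (φ : S1 → ℝ) (x : S1) : ℝ :=
  deriv (fun t : ℝ => φ (x + (t : S1))) 0

/-- The derivative `T'` of a circle map, as a real function on the circle: the derivative at `t = 0`
of the displacement `T (x + t) - T x`, read in the local coordinate. If `F : ℝ → ℝ` is a
differentiable lift of `T`, this is `F'`. -/
noncomputable def mapDeriv (T : S1 → S1) (x : S1) : ℝ :=
  deriv (fun t : ℝ => coord (T (x + (t : S1)) - T x)) 0

/-- The second derivative `T''` of a circle map. -/
noncomputable def mapDeriv2 (T : S1 → S1) : S1 → ℝ := circleDeriv (mapDeriv T)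

/-- The supremum norm of a real function on the circle. -/
noncomputable def supNorm (φ : S1 → ℝ) : ℝ := ⨆ x, |φ x|

/-- The least expansion `inf |T'|`. -/
noncomputable def minExpansion (T : S1 → S1) : ℝ := ⨅ x, |mapDeriv T x|

/-- `T` is a `C³` map of the circle of degree `n` in the unsigned sense (for expanding maps, `n` is
the number of sheets of the covering `T`): it has a `C³` lift `F` with `F (x + 1) = F x ± n`. -/
def IsC3OfDegree (T : S1 → S1) (n : ℕ) : Prop :=
  ∃ F : ℝ → ℝ, ContDiff ℝ 3 F ∧ (∀ x : ℝ, T (x : S1) = (F x : S1)) ∧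
    ∃ d : ℤ, d.natAbs = n ∧ ∀ x : ℝ, F (x + 1) = F x + d

/-- `T` is a `C³` uniformly expanding map of the circle of degree `n`. -/
structure IsExpandingC3 (T : S1 → S1) (n : ℕ) : Prop where
  smooth : IsC3OfDegree T n
  expanding : 1 < minExpansion T

/-- The `C²` distance `‖T - S‖_{C²}` of two circle maps: the largest of the uniform distances
between the maps, their first and their second derivatives. -/
noncomputable def c2Dist (T S : S1 → S1) : ℝ :=
  max (⨆ x, dist (T x) (S x))
    (max (supNorm fun x => mapDeriv T x - mapDeriv S x)
      (supNorm fun x => mapDeriv2 T x - mapDeriv2 S x))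

/-- The `C³` uniformly expanding maps of degree `n` in the `C²` ball of radius `δ` about `T₀`. -/
def expandingBall (n : ℕ) (T₀ : S1 → S1) (δ : ℝ) : Set (S1 → S1) :=
  {T | IsExpandingC3 T n ∧ c2Dist T T₀ ≤ δ}

/-- The Perron-Frobenius (transfer) operator `L_T f (x) = ∑_{T y = x} f y / |T' y|`. -/
noncomputable def transfer (T : S1 → S1) (f : S1 → ℝ) (x : S1) : ℝ :=
  ∑ᶠ y ∈ T ⁻¹' {x}, f y / |mapDeriv T y|

/-- The composition `L^{(j, j + n - 1)} = L_{j + n - 1} ∘ ⋯ ∘ L_{j + 1} ∘ L_j` of the transfer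
operators `L_i` of the maps `T i`; it is the identity for `n = 0`. -/
noncomputable def seqTransfer (T : ℕ → S1 → S1) (j : ℕ) : ℕ → (S1 → ℝ) → S1 → ℝ
  | 0, f => f
  | n + 1, f => transfer (T (j + n)) (seqTransfer T j n f)

/-- The integrable function `v` is a weak derivative of `f`. -/
def IsWeakDeriv (f v : S1 → ℝ) : Prop :=
  Integrable v ∧ ∀ φ : S1 → ℝ, ContDiff ℝ ∞ (fun t : ℝ => φ (t : S1)) →
    ∫ x, f x * circleDeriv φ x = -∫ x, v x * φ x

/-- `f` represents an element of the Sobolev space `W^{1,1}` of the circle. -/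
def MemW11 (f : S1 → ℝ) : Prop := Integrable f ∧ ∃ v, IsWeakDeriv f v

open Classical in
/-- A weak derivative of `f` (unique up to null sets), if there is one. -/
noncomputable def weakDeriv (f : S1 → ℝ) : S1 → ℝ :=
  if h : ∃ v, IsWeakDeriv f v then h.choose else 0

/-- The `L¹` norm. -/
noncomputable def l1Norm (f : S1 → ℝ) : ℝ := ∫ x, |f x|

/-- The `W^{1,1}` norm `‖f‖_{L¹} + ‖f'‖_{L¹}` of a function with `MemW11 f`. -/
noncomputable def w11Norm (f : S1 → ℝ) : ℝ := l1Norm f + l1Norm (weakDeriv f)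

/-- The constant `C(T₀) = 2 n (‖T₀'‖_∞ + λ₀ - 1) (1 / λ₀² + ‖T₀''‖_∞ / λ₀³ + 1 / λ₀)`, where
`λ₀ = inf |T₀'|`, for a map `T₀` of degree `n`. -/
noncomputable def mixedConst (n : ℕ) (T₀ : S1 → S1) : ℝ :=
  2 * n * (supNorm (mapDeriv T₀) + minExpansion T₀ - 1) *
    (1 / minExpansion T₀ ^ 2 + supNorm (mapDeriv2 T₀) / minExpansion T₀ ^ 3 +
      1 / minExpansion T₀)

end CircleMaps

namespace CircleMaps

open Set Filter Topology

/-! Every map in the ball satisfies the same bounds `μ ≤ |T'| ≤ Λ`, `|T''| ≤ D`, with `μ = λ₀ - δ >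
1`. These bounds alone force exponential loss of memory along any sequence of such maps, by two
estimates. Lasota-Yorke (`variation_seqTransfer_le`): `m` steps multiply the variation by at most
`μ⁻¹ ^ m`, up to a fixed multiple `E` of the `L¹` norm, which never grows. Covering
(`l1Norm_seqTransfer_le_of_variation_le`): if `g` has mean zero and variation at most `K ‖g‖₁`, its
positive and negative parts both have mass `‖g‖₁ / 2`, and each is at least half its mean on an
interval of length `1 / N`. Expansion spreads these intervals over the whole circle in `m` steps
with `μ ^ m ≥ N`. Both images then exceed a common positive constant, which cancels in their
difference. In the norm `variation + b * L¹` with `b` large, a fixed number of steps is thus a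
contraction: either the variation is large and Lasota-Yorke shrinks it, or it is controlled and the
`L¹` norm shrinks (`exists_contraction`). Iteration gives the exponential rate. -/

/-! ### Integration and smooth test functions on the circle -/

theorem integrable_iff_integrableOn_Ioc (a : ℝ) (f : S1 → ℝ) :
    Integrable f ↔ IntegrableOn (fun t : ℝ => f (t : S1)) (Ioc a (a + 1)) := by
  have hm := AddCircle.measurePreserving_equivIoc (T := (1 : ℝ)) (a := a)
  have he : MeasurableEmbedding (AddCircle.equivIoc (1 : ℝ) a) :=
    (AddCircle.measurableEquivIoc (1 : ℝ) a).measurableEmbedding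
  have h1 := hm.integrable_comp_emb he (g := fun t : Ioc a (a + 1) => f ((t : ℝ) : S1))
  have h2 : (fun t : Ioc a (a + 1) => f ((t : ℝ) : S1)) ∘ AddCircle.equivIoc (1 : ℝ) a = f := by
    funext x
    exact congrArg f ((AddCircle.equivIoc (1 : ℝ) a).symm_apply_apply x)
  rw [h2] at h1
  rw [h1, IntegrableOn, ← map_comap_subtype_coe measurableSet_Ioc,
    (MeasurableEmbedding.subtype_coe measurableSet_Ioc).integrable_map_iff]
  rfl

theorem integral_eq_intervalIntegral (a : ℝ) (f : S1 → ℝ) :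
    ∫ x, f x = ∫ t in a..a + 1, f (t : S1) :=
  (AddCircle.intervalIntegral_preimage 1 a f).symm

theorem integrable_intervalIntegrable {f : S1 → ℝ} (hf : Integrable f) (a b : ℝ) :
    IntervalIntegrable (fun t : ℝ => f (t : S1)) volume a b := by
  have hp : Function.Periodic (fun t : ℝ => f (t : S1)) 1 := fun t => by simp
  refine hp.intervalIntegrable (t := 0) one_ne_zero ?_ a b
  rw [intervalIntegrable_iff_integrableOn_Ioc_of_le (by norm_num)]
  exact (integrable_iff_integrableOn_Ioc 0 f).1 hf

theorem continuous_of_lift {f : S1 → ℝ} (hf : Continuous fun t : ℝ => f (t : S1)) :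
    Continuous f := continuous_coinduced_dom.2 hf

theorem circleDeriv_coe (φ : S1 → ℝ) (t : ℝ) :
    circleDeriv φ (t : S1) = deriv (fun s : ℝ => φ (s : S1)) t := by
  have h := deriv_comp_const_add (fun s : ℝ => φ (s : S1)) t 0
  simpa [circleDeriv] using h

/-- The function on the circle which agrees with `g` on `[0, 1)`. -/
noncomputable def periodize (g : ℝ → ℝ) (x : S1) : ℝ := g (AddCircle.equivIco (1 : ℝ) 0 x)

theorem periodize_coe (g : ℝ → ℝ) (t : ℝ) : periodize g (t : S1) = g (Int.fract t) := by
  have h := AddCircle.coe_equivIco_mk_apply (1 : ℝ) t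
  simp only [div_one, mul_one] at h
  exact congrArg g h

/-- Away from the integers the fractional part is locally a translation. At an integer it jumps from
1 to 0, but `g` vanishes near both values. -/
theorem contDiff_comp_fract {g : ℝ → ℝ} {N : WithTop ℕ∞} (hg : ContDiff ℝ N g)
    (hs : tsupport g ⊆ Ioo 0 1) : ContDiff ℝ N fun t : ℝ => g (Int.fract t) := by
  rw [contDiff_iff_contDiffAt]
  intro t
  by_cases ht : Int.fract t = 0
  · have hz : ∀ y : ℝ, y ∉ Ioo (0 : ℝ) 1 → ∀ᶠ s in 𝓝 y, g s = 0 := fun y hy =>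
      notMem_tsupport_iff_eventuallyEq.1 fun h => hy (hs h)
    have h0 : ∀ᶠ s in 𝓝 t, g (s - t) = 0 := by
      have : Tendsto (fun s : ℝ => s - t) (𝓝 t) (𝓝 0) := by
        have : ContinuousAt (fun s : ℝ => s - t) t := by fun_prop
        simpa [ContinuousAt] using this
      exact this.eventually (hz 0 (by simp))
    have h1 : ∀ᶠ s in 𝓝 t, g (s - t + 1) = 0 := by
      have : Tendsto (fun s : ℝ => s - t + 1) (𝓝 t) (𝓝 1) := by
        have : ContinuousAt (fun s : ℝ => s - t + 1) t := by fun_prop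
        simpa [ContinuousAt] using this
      exact this.eventually (hz 1 (by simp))
    have h2 : (fun s : ℝ => g (Int.fract s)) =ᶠ[𝓝 t] fun _ => 0 := by
      filter_upwards [h0, h1, Ioo_mem_nhds (show t - 1 < t by linarith)
        (show t < t + 1 by linarith)] with s hs0 hs1 hs2
      have htf : t = (⌊t⌋ : ℝ) := by
        have := Int.floor_add_fract t
        rw [ht] at this
        linarith
      rcases le_or_gt t s with h | h
      · have : Int.fract s = s - t := by
          rw [Int.fract_eq_iff]
          exact ⟨by linarith, by linarith [hs2.2], ⌊t⌋, by linarith⟩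
        rw [this, hs0]
      · have : Int.fract s = s - t + 1 := by
          rw [Int.fract_eq_iff]
          exact ⟨by linarith [hs2.1], by linarith, ⌊t⌋ - 1, by push_cast; linarith⟩
        rw [this, hs1]
    exact contDiffAt_const.congr_of_eventuallyEq h2
  · have h1 : (⌊t⌋ : ℝ) < t := by
      have := Int.floor_add_fract t
      have := lt_of_le_of_ne (Int.fract_nonneg t) (Ne.symm ht)
      linarith
    have h2 : (fun s : ℝ => g (Int.fract s)) =ᶠ[𝓝 t] fun s => g (s - ⌊t⌋) := by
      filter_upwards [Ioo_mem_nhds h1 (Int.lt_floor_add_one t)] with s hs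
      have : Int.fract s = s - ⌊t⌋ := by
        rw [Int.fract_eq_iff]
        exact ⟨by linarith [hs.1], by linarith [hs.2], ⌊t⌋, by ring⟩
      rw [this]
    exact ((hg.comp (contDiff_id.sub contDiff_const)).contDiffAt).congr_of_eventuallyEq h2

/-- Periodized bump functions supported in `(0, 1)` reduce this to the fundamental lemma of the
calculus of variations on an open interval; the omitted point is null. -/
theorem ae_eq_zero_of_integral_smooth {h : S1 → ℝ} (hi : Integrable h)
    (ht : ∀ φ : S1 → ℝ, ContDiff ℝ ∞ (fun t : ℝ => φ (t : S1)) → ∫ x, h x * φ x = 0) :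
    h =ᵐ[volume] 0 := by
  have hi' := (integrable_iff_integrableOn_Ioc 0 h).1 hi
  rw [zero_add] at hi'
  have key : ∀ᵐ t : ℝ, t ∈ Ioo (0 : ℝ) 1 → h (t : S1) = 0 := by
    refine isOpen_Ioo.ae_eq_zero_of_integral_contDiff_smul_eq_zero
      (hi'.mono_set Ioo_subset_Ioc_self).locallyIntegrableOn ?_
    intro g hg _ hs
    have h1 := ht (periodize g) (by simpa only [periodize_coe] using contDiff_comp_fract hg hs)
    rw [← UnitAddCircle.integral_preimage 0, zero_add] at h1
    rw [← h1, integral_Ioc_eq_integral_Ioo, ← integral_indicator measurableSet_Ioo]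
    congr 1
    funext t
    by_cases htm : t ∈ Ioo (0 : ℝ) 1
    · rw [indicator_of_mem htm, periodize_coe, Int.fract_eq_self.2 ⟨htm.1.le, htm.2⟩, smul_eq_mul,
        mul_comm]
    · rw [indicator_of_notMem htm, image_eq_zero_of_notMem_tsupport fun h => htm (hs h), zero_smul]
  have h0 : ∫ x, |h x| = 0 := by
    rw [← UnitAddCircle.integral_preimage 0, zero_add, integral_Ioc_eq_integral_Ioo]
    refine integral_eq_zero_of_ae ?_
    filter_upwards [(ae_restrict_iff' measurableSet_Ioo).2 key] with t ht
    simp [ht]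
  have h1 := (integral_eq_zero_iff_of_nonneg (fun x => abs_nonneg (h x)) hi.abs).1 h0
  filter_upwards [h1] with x hx
  simpa using hx

/-! ### Weak derivatives and primitives -/

/-- `f` is an indefinite integral of the integrable function `v`. -/
def IsPrimitive (f v : S1 → ℝ) : Prop :=
  Integrable v ∧ ∀ a b : ℝ, f (b : S1) - f (a : S1) = ∫ s in a..b, v (s : S1)

/-- Mean zero is what makes the indefinite integral periodic, so that it descends to the circle. -/
theorem exists_isPrimitive {v : S1 → ℝ} (hv : Integrable v) (h0 : ∫ x, v x = 0) :
    ∃ f, IsPrimitive f v := by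
  have hp : Function.Periodic (fun t : ℝ => ∫ s in (0 : ℝ)..t, v (s : S1)) 1 := by
    intro t
    have h1 := integral_eq_intervalIntegral t v
    have h2 := intervalIntegral.integral_add_adjacent_intervals
      (integrable_intervalIntegrable hv 0 t) (integrable_intervalIntegrable hv t (t + 1))
    simp only [← h2, ← h1, h0, add_zero]
  refine ⟨hp.lift, hv, fun a b => ?_⟩
  rw [hp.lift_coe, hp.lift_coe]
  exact intervalIntegral.integral_interval_sub_left (integrable_intervalIntegrable hv 0 b)
    (integrable_intervalIntegrable hv 0 a)

theorem IsPrimitive.lift_eq {f v : S1 → ℝ} (h : IsPrimitive f v) (a : ℝ) :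
    (fun t : ℝ => f (t : S1)) = fun t => f (a : S1) + ∫ s in a..t, v (s : S1) := by
  funext t
  linarith [h.2 a t]

theorem IsPrimitive.continuous {f v : S1 → ℝ} (h : IsPrimitive f v) : Continuous f := by
  apply continuous_of_lift
  rw [h.lift_eq 0]
  exact continuous_const.add
    (intervalIntegral.continuous_primitive (fun a b => integrable_intervalIntegrable h.1 a b) 0)

theorem integrable_of_continuous {f : S1 → ℝ} (hf : Continuous f) : Integrable f :=
  hf.integrable_of_hasCompactSupport (HasCompactSupport.of_compactSpace f)

theorem Integrable.mul_continuous {f φ : S1 → ℝ} (hf : Integrable f) (hφ : Continuous φ) :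
    Integrable fun x => f x * φ x := by
  obtain ⟨C, hC⟩ := (isCompact_range hφ).isBounded.exists_norm_le
  exact hf.mul_bdd (c := C) hφ.aestronglyMeasurable
    (ae_of_all _ fun x => hC _ ⟨x, rfl⟩)

/-- Integration by parts against a `C¹` function on the circle. -/
theorem IsPrimitive.integral_mul_circleDeriv {f v ψ : S1 → ℝ} (h : IsPrimitive f v)
    (hψ : ContDiff ℝ 1 fun t : ℝ => ψ (t : S1)) :
    ∫ x, f x * circleDeriv ψ x = -∫ x, v x * ψ x := by
  rw [integral_eq_intervalIntegral 0, integral_eq_intervalIntegral 0, zero_add]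
  simp only [circleDeriv_coe]
  have hI := (integrable_intervalIntegrable h.1 0 1)
  have hac := hI.absolutelyContinuousOnInterval_intervalIntegral (c := 0) (by simp)
  have hconst : AbsolutelyContinuousOnInterval (fun _ : ℝ => f ((0 : ℝ) : S1)) 0 1 :=
    (contDiff_const (n := 1)).contDiffOn.absolutelyContinuousOnInterval
  have hF : AbsolutelyContinuousOnInterval (fun t : ℝ => f (t : S1)) 0 1 := by
    rw [h.lift_eq 0]
    exact hconst.fun_add hac
  have hG : AbsolutelyContinuousOnInterval (fun t : ℝ => ψ (t : S1)) 0 1 :=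
    hψ.contDiffOn.absolutelyContinuousOnInterval
  rw [hF.integral_mul_deriv_eq_deriv_mul hG]
  have e1 : ((1 : ℝ) : S1) = ((0 : ℝ) : S1) := by simp
  rw [e1, sub_self, zero_sub]
  congr 1
  apply intervalIntegral.integral_congr_ae
  filter_upwards [hI.ae_hasDerivAt_integral] with x hx hx'
  have hd := (hx (uIoc_subset_uIcc hx') 0 (by simp)).const_add (f ((0 : ℝ) : S1))
  rw [← h.lift_eq 0] at hd
  rw [hd.deriv]

theorem exists_smooth_antideriv {ψ : S1 → ℝ} (hψ : ContDiff ℝ ∞ fun t : ℝ => ψ (t : S1)) :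
    ∃ φ : S1 → ℝ, ContDiff ℝ ∞ (fun t : ℝ => φ (t : S1)) ∧
      ∀ x, circleDeriv φ x = ψ x - ∫ y, ψ y := by
  set m := ∫ y, ψ y with hm
  have hc : Continuous ψ := continuous_of_lift hψ.continuous
  have hi : Integrable fun x => ψ x - m := (integrable_of_continuous hc).sub (integrable_const m)
  obtain ⟨φ, hφ⟩ := exists_isPrimitive hi (by
    rw [integral_sub (integrable_of_continuous hc) (integrable_const m)]
    simp [hm, measureReal_def])
  have hd : ∀ t : ℝ, HasDerivAt (fun t : ℝ => φ (t : S1)) (ψ (t : S1) - m) t := by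
    intro t
    rw [hφ.lift_eq 0]
    refine HasDerivAt.const_add _ ?_
    have hcl : Continuous fun t : ℝ => ψ (t : S1) - m := hψ.continuous.sub continuous_const
    exact intervalIntegral.integral_hasDerivAt_right (hcl.intervalIntegrable 0 t)
      hcl.stronglyMeasurable.stronglyMeasurableAtFilter hcl.continuousAt
  refine ⟨φ, ?_, fun x => ?_⟩
  · rw [contDiff_infty_iff_deriv]
    refine ⟨fun t => (hd t).differentiableAt, ?_⟩
    have : deriv (fun t : ℝ => φ (t : S1)) = fun t : ℝ => ψ (t : S1) - m :=
      funext fun t => (hd t).deriv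
    rw [this]
    exact hψ.sub contDiff_const
  · induction x using QuotientAddGroup.induction_on with
    | H t => exact (circleDeriv_coe φ t).trans (hd t).deriv

theorem continuous_circleDeriv {φ : S1 → ℝ} (hφ : ContDiff ℝ 1 fun t : ℝ => φ (t : S1)) :
    Continuous (circleDeriv φ) := by
  apply continuous_of_lift
  simp only [circleDeriv_coe]
  exact hφ.continuous_deriv le_rfl

theorem IsWeakDeriv.integral_eq_zero {f v : S1 → ℝ} (h : IsWeakDeriv f v) : ∫ x, v x = 0 := by
  have h1 := h.2 (fun _ => 1) contDiff_const
  have h2 : ∀ x : S1, circleDeriv (fun _ => 1) x = 0 := fun x => by simp [circleDeriv]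
  simp only [h2, mul_zero, integral_zero, mul_one] at h1
  linarith

/-- Du Bois-Reymond: if `u` is a primitive of `v`, then `f - u` annihilates all derivatives of
smooth functions. By `exists_smooth_antideriv` these are all smooth functions of mean zero, so `f -
u` is a.e. its mean, which is added to `u`. The result is a continuous representative of `f`. -/
theorem IsWeakDeriv.exists_isPrimitive {f v : S1 → ℝ} (hf : Integrable f)
    (h : IsWeakDeriv f v) : ∃ u, IsPrimitive u v ∧ f =ᵐ[volume] u := by
  obtain ⟨u, hu⟩ := CircleMaps.exists_isPrimitive h.1 h.integral_eq_zero
  have hui := integrable_of_continuous hu.continuous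
  have hfu : Integrable fun x => f x - u x := hf.sub hui
  set m := ∫ x, (f x - u x) with hm
  have key : (fun x => f x - u x - m) =ᵐ[volume] 0 := by
    refine ae_eq_zero_of_integral_smooth (hfu.sub (integrable_const m)) fun ψ hψ => ?_
    obtain ⟨φ, hφ, hd⟩ := exists_smooth_antideriv hψ
    have hψc : Continuous ψ := continuous_of_lift hψ.continuous
    have hψi := integrable_of_continuous hψc
    have hφ1 : ContDiff ℝ 1 fun t : ℝ => φ (t : S1) := hφ.of_le (by exact_mod_cast le_top)
    have hdc := continuous_circleDeriv hφ1
    have h1 : ∫ x, (f x - u x) * circleDeriv φ x = 0 := by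
      simp only [sub_mul]
      rw [integral_sub (Integrable.mul_continuous hf hdc) (Integrable.mul_continuous hui hdc),
        h.2 φ hφ, hu.integral_mul_circleDeriv hφ1, sub_self]
    simp only [hd, mul_sub] at h1
    rw [integral_sub (Integrable.mul_continuous hfu hψc) (hfu.mul_const _),
      integral_mul_const, ← hm] at h1
    simp only [sub_mul _ m]
    rw [integral_sub (Integrable.mul_continuous hfu hψc) (hψi.const_mul _), integral_const_mul]
    exact h1
  refine ⟨fun x => u x + m, ⟨h.1, fun a b => ?_⟩, ?_⟩
  · rw [← hu.2]; ring
  · filter_upwards [key] with x hx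
    simp only [Pi.zero_apply] at hx
    linarith

theorem IsWeakDeriv.ae_eq {f v w : S1 → ℝ} (hv : IsWeakDeriv f v) (hw : IsWeakDeriv f w) :
    v =ᵐ[volume] w := by
  have h : (fun x => v x - w x) =ᵐ[volume] 0 := by
    refine ae_eq_zero_of_integral_smooth (hv.1.sub hw.1) fun φ hφ => ?_
    have hc : Continuous φ := continuous_of_lift hφ.continuous
    simp only [sub_mul]
    rw [integral_sub (Integrable.mul_continuous hv.1 hc) (Integrable.mul_continuous hw.1 hc)]
    linarith [hv.2 φ hφ, hw.2 φ hφ]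
  filter_upwards [h] with x hx
  simp only [Pi.zero_apply] at hx
  linarith

theorem MemW11.isWeakDeriv_weakDeriv {f : S1 → ℝ} (hf : MemW11 f) :
    IsWeakDeriv f (weakDeriv f) := by
  rw [weakDeriv, dif_pos hf.2]
  exact hf.2.choose_spec

theorem IsWeakDeriv.l1Norm_weakDeriv {f v : S1 → ℝ} (hv : IsWeakDeriv f v) :
    l1Norm (weakDeriv f) = l1Norm v := by
  have h : IsWeakDeriv f (weakDeriv f) := by
    rw [weakDeriv, dif_pos ⟨v, hv⟩]
    exact Exists.choose_spec (⟨v, hv⟩ : ∃ v, IsWeakDeriv f v)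
  refine integral_congr_ae ?_
  filter_upwards [h.ae_eq hv] with x hx
  rw [hx]

/-! ### Lifts of expanding maps and their inverse branches -/

theorem coe_eq_coe_iff {x y : ℝ} : (x : S1) = (y : S1) ↔ ∃ m : ℤ, x = y + m := by
  rw [← sub_eq_zero, ← AddCircle.coe_sub, AddCircle.coe_eq_zero_iff]
  refine exists_congr fun m => ?_
  rw [zsmul_one, eq_comm, sub_eq_iff_eq_add']

/-- `F` is a `C³` lift of the expanding map `T`, with inverse `G`, of degree `d`. -/
structure IsLift (T : S1 → S1) (d : ℤ) (F G : ℝ → ℝ) : Prop where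
  contDiff : ContDiff ℝ 3 F
  coe : ∀ x : ℝ, T (x : S1) = (F x : S1)
  add_one : ∀ x : ℝ, F (x + 1) = F x + d
  right_inv : ∀ y, F (G y) = y
  left_inv : ∀ x, G (F x) = x
  monotonicity : (StrictMono G ∧ 0 < d) ∨ (StrictAnti G ∧ d < 0)
  deriv_ne_zero : ∀ x, deriv F x ≠ 0
  continuous_inv : Continuous G

theorem coord_coe {t : ℝ} (h1 : -1 / 2 ≤ t) (h2 : t < 1 / 2) : coord (t : S1) = t :=
  AddCircle.equivIco_coe_of_mem (p := (1 : ℝ)) (a := -1 / 2) ⟨h1, by linarith⟩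

theorem mapDeriv_of_lift {T : S1 → S1} {F : ℝ → ℝ} (hF : Continuous F)
    (h : ∀ x : ℝ, T (x : S1) = (F x : S1)) (x : ℝ) : mapDeriv T (x : S1) = deriv F x := by
  have h1 : (fun t : ℝ => coord (T ((x : S1) + (t : S1)) - T (x : S1))) =ᶠ[𝓝 0]
      fun t => F (x + t) - F x := by
    have hc : Tendsto (fun t => F (x + t) - F x) (𝓝 0) (𝓝 0) := by
      have : ContinuousAt (fun t => F (x + t) - F x) 0 := by fun_prop
      simpa [ContinuousAt] using this
    filter_upwards [hc (Ioo_mem_nhds (show (-1 / 2 : ℝ) < 0 by norm_num)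
      (show (0 : ℝ) < 1 / 2 by norm_num))] with t ht
    rw [← AddCircle.coe_add, h, h, ← AddCircle.coe_sub]
    exact coord_coe ht.1.le ht.2
  rw [mapDeriv, h1.deriv_eq, deriv_sub_const, deriv_comp_const_add, add_zero]

theorem IsC3OfDegree.continuous_mapDeriv {T : S1 → S1} {n : ℕ} (h : IsC3OfDegree T n) :
    Continuous (mapDeriv T) := by
  obtain ⟨F, hF, hT, -⟩ := h
  apply continuous_of_lift
  simp only [mapDeriv_of_lift hF.continuous hT]
  exact hF.continuous_deriv (by norm_num)

theorem IsC3OfDegree.contDiff_mapDeriv {T : S1 → S1} {n : ℕ} (h : IsC3OfDegree T n) :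
    ContDiff ℝ 1 fun t : ℝ => mapDeriv T (t : S1) := by
  obtain ⟨F, hF, hT, -⟩ := h
  simp only [mapDeriv_of_lift hF.continuous hT]
  have h3 : ContDiff ℝ (2 + 1) F := by
    have e : (2 + 1 : WithTop ℕ∞) = 3 := by norm_num
    rwa [e]
  exact (contDiff_succ_iff_deriv.1 h3).2.2.of_le (by norm_num)

theorem IsC3OfDegree.continuous_mapDeriv2 {T : S1 → S1} {n : ℕ} (h : IsC3OfDegree T n) :
    Continuous (mapDeriv2 T) := continuous_circleDeriv h.contDiff_mapDeriv

theorem IsC3OfDegree.continuous {T : S1 → S1} {n : ℕ} (h : IsC3OfDegree T n) :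
    Continuous T := by
  obtain ⟨F, hF, hT, -⟩ := h
  refine continuous_coinduced_dom.2 ?_
  have : T ∘ ((↑) : ℝ → S1) = fun t => ((F t : ℝ) : S1) := funext hT
  exact this ▸ (AddCircle.continuous_mk' (1 : ℝ)).comp hF.continuous

theorem bddAbove_range_abs {f : S1 → ℝ} (hf : Continuous f) :
    BddAbove (range fun x => |f x|) := (isCompact_range hf.abs).bddAbove

theorem abs_le_supNorm {f : S1 → ℝ} (hf : Continuous f) (x : S1) : |f x| ≤ supNorm f :=
  le_ciSup (bddAbove_range_abs hf) x

theorem minExpansion_le (T : S1 → S1) (x : S1) : minExpansion T ≤ |mapDeriv T x| :=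
  ciInf_le ⟨0, by rintro _ ⟨y, rfl⟩; exact abs_nonneg _⟩ x

/-- An increasing surjection of the line with derivative bounded below. -/
theorem exists_orderIso_of_le_deriv {F : ℝ → ℝ} (hF : Differentiable ℝ F) {μ : ℝ} (hμ : 0 < μ)
    (h : ∀ x, μ ≤ deriv F x) : ∃ e : ℝ ≃o ℝ, ∀ x, e x = F x := by
  have hm : StrictMono F := strictMono_of_deriv_pos fun x => hμ.trans_le (h x)
  have hs : Function.Surjective F := by
    refine hF.continuous.surjective ?_ ?_
    · refine tendsto_atTop_mono' _ ?_ (tendsto_atTop_add_const_right _ (F 0)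
        (tendsto_id.const_mul_atTop hμ))
      filter_upwards [eventually_ge_atTop 0] with x hx
      have := mul_sub_le_image_sub_of_le_deriv hF h hx
      simp only [id]
      linarith
    · refine tendsto_atBot_mono' _ ?_ (tendsto_atBot_add_const_right _ (F 0)
        (tendsto_id.const_mul_atBot hμ))
      filter_upwards [eventually_le_atBot 0] with x hx
      have := mul_sub_le_image_sub_of_le_deriv hF h hx
      simp only [id]
      linarith
  exact ⟨hm.orderIsoOfSurjective F hs, fun x => rfl⟩

/-- The derivative of a lift is continuous with absolute value at least 1, so it has constant sign
and the lift is a bijection of the line. The orientation-reversing case is the same argument for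
`-F`. -/
theorem IsExpandingC3.exists_isLift {T : S1 → S1} {n : ℕ} (h : IsExpandingC3 T n) :
    ∃ (d : ℤ) (F G : ℝ → ℝ), IsLift T d F G ∧ d.natAbs = n := by
  obtain ⟨F, hF, hT, d, hd, hadd⟩ := h.smooth
  have hdiff : Differentiable ℝ F := hF.differentiable (by norm_num)
  have habs : ∀ x, 1 ≤ |deriv F x| := fun x => by
    rw [← mapDeriv_of_lift hF.continuous hT]
    exact h.expanding.le.trans (minExpansion_le T x)
  have hne : ∀ x, deriv F x ≠ 0 := fun x h0 => by
    have := habs x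
    rw [h0, abs_zero] at this
    linarith
  have hc : Continuous (deriv F) := hF.continuous_deriv (by norm_num)
  have hsign : (∀ x, 0 < deriv F x) ∨ ∀ x, deriv F x < 0 := by
    by_contra! hcon
    obtain ⟨⟨a, ha⟩, b, hb⟩ := hcon
    obtain ⟨c, hc⟩ := mem_range_of_exists_le_of_exists_ge hc ⟨a, ha⟩ ⟨b, hb⟩
    exact hne c hc
  rcases hsign with hs | hs
  · obtain ⟨e, he⟩ := exists_orderIso_of_le_deriv hdiff one_pos fun x => by
      rw [← abs_of_pos (hs x)]; exact habs x
    refine ⟨d, F, e.symm, ⟨hF, hT, hadd, fun y => by rw [← he, e.apply_symm_apply], fun x => by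
      rw [← he, e.symm_apply_apply], Or.inl ⟨e.symm.strictMono, ?_⟩, hne, e.symm.continuous⟩, hd⟩
    have h1 : F 0 < F (0 + 1) := by
      rw [← he, ← he]; exact e.strictMono (by norm_num)
    rw [hadd] at h1
    exact_mod_cast (lt_add_iff_pos_right _).1 h1
  · obtain ⟨e, he⟩ := exists_orderIso_of_le_deriv (F := fun x => - F x) hdiff.neg one_pos
      fun x => by rw [deriv.fun_neg, ← abs_of_neg (hs x)]; exact habs x
    have he' : ∀ x, F x = - e x := fun x => by rw [he, neg_neg]
    refine ⟨d, F, fun y => e.symm (-y), ⟨hF, hT, hadd, fun y => by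
      rw [he', e.apply_symm_apply, neg_neg], fun x => by
      rw [he', neg_neg, e.symm_apply_apply], Or.inr ⟨fun a b hab =>
        e.symm.strictMono (neg_lt_neg hab), ?_⟩, hne, e.symm.continuous.comp continuous_neg⟩, hd⟩
    have h1 : F (0 + 1) < F 0 := by
      rw [he', he']; exact neg_lt_neg (e.strictMono (by norm_num))
    rw [hadd] at h1
    have h2 : (d : ℝ) < 0 := by linarith
    exact_mod_cast h2

namespace IsLift

variable {T : S1 → S1} {d : ℤ} {F G : ℝ → ℝ}

theorem mapDeriv_coe (h : IsLift T d F G) (x : ℝ) : mapDeriv T (x : S1) = deriv F x :=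
  mapDeriv_of_lift h.contDiff.continuous h.coe x

theorem differentiable (h : IsLift T d F G) : Differentiable ℝ F :=
  h.contDiff.differentiable (by norm_num)

theorem hasDerivAt_inv (h : IsLift T d F G) (y : ℝ) : HasDerivAt G (deriv F (G y))⁻¹ y :=
  (h.differentiable (G y)).hasDerivAt.of_local_left_inverse h.continuous_inv.continuousAt
    (h.deriv_ne_zero _) (Eventually.of_forall h.right_inv)

theorem add_int (h : IsLift T d F G) (x : ℝ) (k : ℤ) : F (x + k) = F x + d * k := by
  induction k using Int.induction_on with
  | zero => simp
  | succ k ih =>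
    push_cast at ih ⊢
    rw [← add_assoc, h.add_one, ih]; ring
  | pred k ih =>
    have h1 := h.add_one (x + (-(k : ℝ) - 1))
    rw [show x + (-(k : ℝ) - 1) + 1 = x + -(k : ℝ) by ring] at h1
    push_cast at ih ⊢
    rw [ih] at h1
    linarith

theorem inv_add (h : IsLift T d F G) (y : ℝ) (k : ℤ) : G (y + d * k) = G y + k := by
  rw [← h.left_inv (G y + k), h.add_int, h.right_inv]

theorem natAbs_pos (h : IsLift T d F G) : 0 < d.natAbs := by
  rcases h.monotonicity with ⟨_, h⟩ | ⟨_, h⟩ <;> omega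

/-- Adding a multiple of `d` to the argument of `G` moves its value by an integer, invisible on the
circle; so only the residue of `k` modulo `d` counts. -/
theorem preimage_singleton (h : IsLift T d F G) (x : ℝ) :
    T ⁻¹' {(x : S1)} = (fun k : ℕ => (G (x + k) : S1)) '' (Finset.range d.natAbs : Set ℕ) := by
  have hd : d ≠ 0 := by have := h.natAbs_pos; omega
  ext y
  induction y using QuotientAddGroup.induction_on with
  | H t =>
    change T (t : S1) = (x : S1) ↔ _
    rw [h.coe, coe_eq_coe_iff]
    constructor
    · rintro ⟨m, hm⟩
      have hr0 : 0 ≤ m % d := Int.emod_nonneg m hd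
      have hr1 := Int.emod_lt m hd
      refine ⟨(m % d).toNat, ?_, ?_⟩
      · simp only [Finset.coe_range, mem_Iio]
        omega
      · have hc : (((m % d).toNat : ℕ) : ℝ) = ((m % d : ℤ) : ℝ) := by
          exact_mod_cast Int.toNat_of_nonneg hr0
        have hmd : (m : ℝ) = ((m % d : ℤ) : ℝ) + d * ((m / d : ℤ) : ℝ) := by
          exact_mod_cast (Int.emod_add_mul_ediv m d).symm
        have ht : t = G (x + ((m % d : ℤ) : ℝ)) + ((m / d : ℤ) : ℝ) := by
          rw [← h.inv_add, ← h.left_inv t, hm, hmd, add_assoc]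
        change (G (x + ((m % d).toNat : ℕ)) : S1) = (t : S1)
        rw [coe_eq_coe_iff, hc]
        exact ⟨-(m / d), by push_cast; linarith⟩
    · rintro ⟨k, -, hk⟩
      change (G (x + k) : S1) = (t : S1) at hk
      rw [← coe_eq_coe_iff, ← h.coe, ← hk, h.coe, h.right_inv, coe_eq_coe_iff]
      exact ⟨k, by simp⟩

theorem injOn_branches (h : IsLift T d F G) (x : ℝ) :
    InjOn (fun k : ℕ => (G (x + k) : S1)) (Finset.range d.natAbs : Set ℕ) := by
  intro k hk l hl hkl
  simp only [Finset.coe_range, mem_Iio] at hk hl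
  obtain ⟨m, hm⟩ := coe_eq_coe_iff.1 hkl
  have h1 := h.right_inv (x + k)
  rw [hm, h.add_int, h.right_inv] at h1
  have h2 : (k : ℤ) - l = d * m := by
    have : ((k : ℝ) - l) = d * m := by linarith
    exact_mod_cast this
  have h3 : (d.natAbs : ℤ) ∣ (k : ℤ) - l := Int.natAbs_dvd.2 ⟨m, h2⟩
  have h4 := Int.eq_zero_of_abs_lt_dvd h3 (by rw [abs_lt]; constructor <;> omega)
  omega

theorem transfer_coe (h : IsLift T d F G) (f : S1 → ℝ) (x : ℝ) :
    transfer T f (x : S1) = ∑ k ∈ Finset.range d.natAbs,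
      |(deriv F (G (x + k)))⁻¹| • f (G (x + k) : S1) := by
  rw [transfer, h.preimage_singleton, finsum_mem_image (h.injOn_branches x),
    finsum_mem_coe_finset]
  refine Finset.sum_congr rfl fun k _ => ?_
  rw [h.mapDeriv_coe, abs_inv, smul_eq_mul, div_eq_inv_mul]

/-- The inverse lift carries `|d|` turns of the target onto one turn of the source. When `G`
decreases, the closed end of the interval switches sides, hence the equality only up to null sets.
-/
theorem image_inv_ae (h : IsLift T d F G) :
    ∃ a : ℝ, (G '' Ioc 0 (d.natAbs : ℝ) : Set ℝ) =ᵐ[volume] Ioc a (a + 1) := by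
  have him : G '' Ioc 0 (d.natAbs : ℝ) = F ⁻¹' Ioc 0 (d.natAbs : ℝ) :=
    congrFun (image_eq_preimage_of_inverse h.right_inv h.left_inv) _
  rw [him]
  rcases h.monotonicity with ⟨hm, hd⟩ | ⟨hm, hd⟩
  · refine ⟨G 0, ?_⟩
    have hn : ((d.natAbs : ℕ) : ℝ) = d := by
      rw [Nat.cast_natAbs, abs_of_pos hd]
    have h1 := h.inv_add 0 1
    simp only [zero_add, Int.cast_one, mul_one] at h1
    rw [← h1, hn]
    refine Eventually.of_forall fun x => propext ?_
    change (0 < F x ∧ F x ≤ d) ↔ (G 0 < x ∧ x ≤ G d)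
    rw [← hm.lt_iff_lt, ← hm.le_iff_le, h.left_inv]
  · refine ⟨G (d.natAbs : ℝ), ?_⟩
    have hn : ((d.natAbs : ℕ) : ℝ) = -d := by
      rw [Nat.cast_natAbs, abs_of_neg hd, Int.cast_neg]
    have h1 := h.inv_add (-d) 1
    simp only [Int.cast_one, mul_one, neg_add_cancel] at h1
    rw [hn, ← h1]
    refine EventuallyEq.trans (Eventually.of_forall fun x => propext ?_) Ico_ae_eq_Ioc
    change (0 < F x ∧ F x ≤ -d) ↔ (G (-d) ≤ x ∧ x < G 0)
    rw [← hm.lt_iff_gt, ← hm.le_iff_ge, h.left_inv, and_comm]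

theorem integrableOn_branches (h : IsLift T d F G) {f : S1 → ℝ} (hf : Integrable f) :
    IntegrableOn (fun y => |(deriv F (G y))⁻¹| • f (G y : S1)) (Ioc 0 (d.natAbs : ℝ)) := by
  obtain ⟨a, ha⟩ := h.image_inv_ae
  rw [← integrableOn_image_iff_integrableOn_abs_deriv_smul measurableSet_Ioc
    (fun y _ => (h.hasDerivAt_inv y).hasDerivWithinAt)
    (Function.LeftInverse.injective h.right_inv).injOn (fun t : ℝ => f (t : S1)),
    integrableOn_congr_set_ae ha]
  exact (integrable_iff_integrableOn_Ioc a f).1 hf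

theorem intervalIntegrable_branch (h : IsLift T d F G) {f : S1 → ℝ} (hf : Integrable f) {k : ℕ}
    (hk : k < d.natAbs) :
    IntervalIntegrable (fun y => |(deriv F (G y))⁻¹| • f (G y : S1)) volume k (k + 1 : ℕ) := by
  rw [intervalIntegrable_iff_integrableOn_Ioc_of_le (by simp)]
  refine (h.integrableOn_branches hf).mono_set (Ioc_subset_Ioc (by simp) ?_)
  exact_mod_cast hk

theorem intervalIntegrable_branch_shift (h : IsLift T d F G) {f : S1 → ℝ} (hf : Integrable f)
    {k : ℕ} (hk : k < d.natAbs) :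
    IntervalIntegrable (fun x : ℝ => |(deriv F (G (x + k)))⁻¹| • f (G (x + k) : S1))
      volume 0 1 := by
  have h1 := (h.intervalIntegrable_branch hf hk).comp_add_right (k : ℝ)
  simpa using h1

theorem integrable_transfer (h : IsLift T d F G) {f : S1 → ℝ} (hf : Integrable f) :
    Integrable (transfer T f) := by
  rw [integrable_iff_integrableOn_Ioc 0, zero_add,
    ← intervalIntegrable_iff_integrableOn_Ioc_of_le zero_le_one]
  simp only [h.transfer_coe]
  have h1 := IntervalIntegrable.sum (Finset.range d.natAbs) fun k hk =>
    h.intervalIntegrable_branch_shift hf (Finset.mem_range.1 hk)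
  exact h1.congr fun x _ => Finset.sum_apply _ _ _

/-- The branches over `[0, 1]`, laid end to end, form one integral over `(0, |d|]`, and the
substitution by `G` turns it into an integral over one turn. -/
theorem integral_transfer (h : IsLift T d F G) {f : S1 → ℝ} (hf : Integrable f) :
    ∫ x, transfer T f x = ∫ x, f x := by
  obtain ⟨a, ha⟩ := h.image_inv_ae
  rw [integral_eq_intervalIntegral 0, zero_add]
  simp only [h.transfer_coe]
  rw [intervalIntegral.integral_finsetSum fun k hk =>
    h.intervalIntegrable_branch_shift hf (Finset.mem_range.1 hk)]
  have h1 : ∀ k : ℕ, ∫ x in (0 : ℝ)..1, |(deriv F (G (x + k)))⁻¹| • f (G (x + k) : S1) =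
      ∫ y in (k : ℝ)..(k + 1 : ℕ), |(deriv F (G y))⁻¹| • f (G y : S1) := fun k => by
    rw [intervalIntegral.integral_comp_add_right
      (fun y => |(deriv F (G y))⁻¹| • f (G y : S1)) (k : ℝ)]
    simp [add_comm]
  simp only [h1]
  rw [intervalIntegral.sum_integral_adjacent_intervals (a := fun k : ℕ => (k : ℝ)) fun k hk =>
    h.intervalIntegrable_branch hf hk, Nat.cast_zero, intervalIntegral.integral_of_le (by simp),
    ← integral_image_eq_integral_abs_deriv_smul measurableSet_Ioc
    (fun y _ => (h.hasDerivAt_inv y).hasDerivWithinAt)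
    (Function.LeftInverse.injective h.right_inv).injOn (fun t : ℝ => f (t : S1)),
    setIntegral_congr_set ha]
  exact UnitAddCircle.integral_preimage a f

theorem transfer_sub (h : IsLift T d F G) (f g : S1 → ℝ) (x : S1) :
    transfer T (fun y => f y - g y) x = transfer T f x - transfer T g x := by
  induction x using QuotientAddGroup.induction_on with
  | H t =>
    rw [h.transfer_coe, h.transfer_coe, h.transfer_coe, ← Finset.sum_sub_distrib]
    simp only [smul_sub]

theorem abs_transfer_le (h : IsLift T d F G) (f : S1 → ℝ) (x : S1) :
    |transfer T f x| ≤ transfer T (fun y => |f y|) x := by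
  induction x using QuotientAddGroup.induction_on with
  | H t =>
    rw [h.transfer_coe, h.transfer_coe]
    refine (Finset.abs_sum_le_sum_abs _ _).trans (Finset.sum_le_sum fun k _ => ?_)
    rw [smul_eq_mul, abs_mul, abs_abs, smul_eq_mul]

theorem _root_.CircleMaps.transfer_nonneg (T : S1 → S1) {f : S1 → ℝ} (hf : ∀ x, 0 ≤ f x) (x : S1) :
    0 ≤ transfer T f x :=
  finsum_nonneg fun y => finsum_nonneg fun _ => div_nonneg (hf y) (abs_nonneg _)

/-- The transfer operator commutes with multiplication by functions of `T`. -/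
theorem transfer_mul_comp (h : IsLift T d F G) (f φ : S1 → ℝ)
    (x : S1) :
    transfer T (fun y => f y * φ (T y)) x = transfer T f x * φ x := by
  induction x using QuotientAddGroup.induction_on with
  | H t =>
    rw [h.transfer_coe, h.transfer_coe, Finset.sum_mul]
    refine Finset.sum_congr rfl fun k _ => ?_
    have : T (G (t + k) : S1) = (t : S1) := by
      rw [h.coe, h.right_inv, coe_eq_coe_iff]
      exact ⟨k, by simp⟩
    rw [this, smul_eq_mul, smul_eq_mul, mul_assoc]

theorem le_transfer (h : IsLift T d F G) {f : S1 → ℝ} (hf : ∀ x, 0 ≤ f x) (t : ℝ) :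
    f (t : S1) / |mapDeriv T (t : S1)| ≤ transfer T f (F t : S1) := by
  rw [← h.coe]
  have hfin : (T ⁻¹' {T (t : S1)}).Finite := by
    rw [h.coe, h.preimage_singleton]
    exact (Finset.finite_toSet _).image _
  rw [transfer, finsum_mem_eq_finite_toFinset_sum _ hfin]
  exact Finset.single_le_sum (f := fun y => f y / |mapDeriv T y|)
    (fun y _ => div_nonneg (hf y) (abs_nonneg _)) (hfin.mem_toFinset.2 rfl)

theorem l1Norm_transfer_le (h : IsLift T d F G) {f : S1 → ℝ} (hf : Integrable f) :
    l1Norm (transfer T f) ≤ l1Norm f := by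
  rw [l1Norm, l1Norm, ← h.integral_transfer hf.abs]
  exact integral_mono (h.integrable_transfer hf).abs (h.integrable_transfer hf.abs)
    (h.abs_transfer_le f)

/-- The operator is defined pointwise by sums over fibres; that it respects null sets comes from the
`L¹` contraction applied to `f - g`. -/
theorem transfer_ae_eq (h : IsLift T d F G) {f g : S1 → ℝ} (hf : Integrable f)
    (hfg : f =ᵐ[volume] g) : transfer T f =ᵐ[volume] transfer T g := by
  have hg : Integrable g := hf.congr hfg
  have h0 : ∫ x, |transfer T (fun y => f y - g y) x| ≤ 0 := by
    refine (h.l1Norm_transfer_le (hf.sub hg)).trans (le_of_eq (integral_eq_zero_of_ae ?_))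
    filter_upwards [hfg] with x hx
    simp [hx]
  have h1 := (integral_eq_zero_iff_of_nonneg (fun x => abs_nonneg _)
    (h.integrable_transfer (hf.sub hg)).abs).1 (h0.antisymm (integral_nonneg fun x => abs_nonneg _))
  filter_upwards [h1] with x hx
  have : transfer T (fun y => f y - g y) x = 0 := abs_eq_zero.1 hx
  rw [h.transfer_sub] at this
  linarith

end IsLift
-- Weak derivative of a transferred function and Lasota-Yorke
-- Needed because the test function `φ ∘ T / T'` used below inherits only the finite smoothness of
-- `T`.
theorem IsWeakDeriv.integral_mul_circleDeriv {f v ψ : S1 → ℝ} (hf : Integrable f)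
    (h : IsWeakDeriv f v) (hψ : ContDiff ℝ 1 fun t : ℝ => ψ (t : S1)) :
    ∫ x, f x * circleDeriv ψ x = -∫ x, v x * ψ x := by
  obtain ⟨u, hu, hfu⟩ := h.exists_isPrimitive hf
  rw [← hu.integral_mul_circleDeriv hψ]
  refine integral_congr_ae ?_
  filter_upwards [hfu] with x hx
  rw [hx]

/-- The function `v / T' - f T'' / T' ^ 2`; if `v` is the weak derivative of `f`, its transfer is the
weak derivative of the transfer of `f`. -/
noncomputable def derivDensity (T : S1 → S1) (f v : S1 → ℝ) (x : S1) : ℝ :=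
  v x * (mapDeriv T x)⁻¹ - f x * (mapDeriv2 T x * ((mapDeriv T x)⁻¹) ^ 2)

namespace IsLift

variable {T : S1 → S1} {d : ℤ} {F G : ℝ → ℝ}

theorem isC3OfDegree (h : IsLift T d F G) : IsC3OfDegree T d.natAbs :=
  ⟨F, h.contDiff, h.coe, d, rfl, h.add_one⟩

theorem mapDeriv_ne_zero (h : IsLift T d F G) (x : S1) : mapDeriv T x ≠ 0 := by
  induction x using QuotientAddGroup.induction_on with
  | H t => exact h.mapDeriv_coe t ▸ h.deriv_ne_zero t

theorem continuous_inv_mapDeriv (h : IsLift T d F G) :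
    Continuous fun x => (mapDeriv T x)⁻¹ :=
  h.isC3OfDegree.continuous_mapDeriv.inv₀ h.mapDeriv_ne_zero

theorem integrable_derivDensity (h : IsLift T d F G) {f v : S1 → ℝ} (hf : Integrable f)
    (hv : Integrable v) : Integrable (derivDensity T f v) :=
  (Integrable.mul_continuous hv h.continuous_inv_mapDeriv).sub
    (Integrable.mul_continuous hf
      (h.isC3OfDegree.continuous_mapDeriv2.mul (h.continuous_inv_mapDeriv.pow 2)))

theorem circleDeriv_comp_div (h : IsLift T d F G) {φ : S1 → ℝ}
    (hφ : ContDiff ℝ 1 fun t : ℝ => φ (t : S1)) (x : S1) :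
    circleDeriv (fun y => φ (T y) * (mapDeriv T y)⁻¹) x =
      circleDeriv φ (T x) - φ (T x) * (mapDeriv2 T x * ((mapDeriv T x)⁻¹) ^ 2) := by
  induction x using QuotientAddGroup.induction_on with
  | H t =>
    have h1 := (hφ.differentiable one_ne_zero (F t)).hasDerivAt.comp t
      (h.differentiable t).hasDerivAt
    have h2 := (h.isC3OfDegree.contDiff_mapDeriv.differentiable one_ne_zero t).hasDerivAt
    have h3 := h1.mul (h2.inv (h.mapDeriv_ne_zero t))
    have e : (fun s : ℝ => φ (T (s : S1)) * (mapDeriv T (s : S1))⁻¹) =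
        ((fun t : ℝ => φ (t : S1)) ∘ F) * (fun s : ℝ => mapDeriv T (s : S1))⁻¹ := by
      funext s
      simp [h.coe]
    have hne : deriv F t ≠ 0 := h.deriv_ne_zero t
    refine (circleDeriv_coe _ t).trans ?_
    rw [e, h3.deriv, mapDeriv2]
    simp only [circleDeriv_coe, h.coe, Function.comp, Pi.inv_apply, h.mapDeriv_coe]
    field_simp
    ring

theorem contDiff_comp_div (h : IsLift T d F G) {φ : S1 → ℝ}
    (hφ : ContDiff ℝ 1 fun t : ℝ => φ (t : S1)) :
    ContDiff ℝ 1 fun t : ℝ => φ (T (t : S1)) * (mapDeriv T (t : S1))⁻¹ := by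
  simp only [h.coe]
  exact (hφ.comp (h.contDiff.of_le (by norm_num))).mul
    (h.isC3OfDegree.contDiff_mapDeriv.inv fun t => h.mapDeriv_ne_zero t)

theorem integral_transfer_mul (h : IsLift T d F G) {f φ : S1 → ℝ} (hf : Integrable f)
    (hφ : Continuous φ) : ∫ x, transfer T f x * φ x = ∫ x, f x * φ (T x) := by
  have hc : Continuous fun x => φ (T x) := hφ.comp h.isC3OfDegree.continuous
  rw [← h.integral_transfer (Integrable.mul_continuous hf hc)]
  exact integral_congr_ae (Eventually.of_forall fun x => (h.transfer_mul_comp f φ x).symm)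

/-- By duality `∫ (L f) φ' = ∫ f (φ' ∘ T)`, and `φ' ∘ T` is the derivative of `φ ∘ T / T'` plus a
distortion term in `T''`. Testing `f` against `φ ∘ T / T'` gives `derivDensity`. -/
theorem isWeakDeriv_transfer (h : IsLift T d F G) {f v : S1 → ℝ} (hf : Integrable f)
    (hv : IsWeakDeriv f v) : IsWeakDeriv (transfer T f) (transfer T (derivDensity T f v)) := by
  refine ⟨h.integrable_transfer (h.integrable_derivDensity hf hv.1), fun φ hφ => ?_⟩
  have hφ1 : ContDiff ℝ 1 fun t : ℝ => φ (t : S1) := hφ.of_le (by exact_mod_cast le_top)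
  have hφT : Continuous fun x => φ (T x) :=
    (continuous_of_lift hφ.continuous).comp h.isC3OfDegree.continuous
  have hdc : Continuous fun x => circleDeriv φ (T x) :=
    (continuous_circleDeriv hφ1).comp h.isC3OfDegree.continuous
  have hinv := h.continuous_inv_mapDeriv
  have hdist : Continuous fun x => φ (T x) * (mapDeriv2 T x * ((mapDeriv T x)⁻¹) ^ 2) :=
    hφT.mul (h.isC3OfDegree.continuous_mapDeriv2.mul (hinv.pow 2))
  rw [h.integral_transfer_mul hf (continuous_circleDeriv hφ1),
    h.integral_transfer_mul (h.integrable_derivDensity hf hv.1) (continuous_of_lift hφ.continuous)]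
  have h1 := hv.integral_mul_circleDeriv (ψ := fun y => φ (T y) * (mapDeriv T y)⁻¹) hf
    (h.contDiff_comp_div hφ1)
  simp only [h.circleDeriv_comp_div hφ1, mul_sub] at h1
  rw [integral_sub (Integrable.mul_continuous hf hdc) (Integrable.mul_continuous hf hdist)] at h1
  have h2 : ∀ x, derivDensity T f v x * φ (T x) = v x * (φ (T x) * (mapDeriv T x)⁻¹) -
      f x * (φ (T x) * (mapDeriv2 T x * ((mapDeriv T x)⁻¹) ^ 2)) := fun x => by
    rw [derivDensity]; ring
  simp only [h2]
  have hq : Continuous fun x => φ (T x) * (mapDeriv T x)⁻¹ := hφT.mul hinv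
  rw [integral_sub (Integrable.mul_continuous hv.1 hq)
    (Integrable.mul_continuous hf hdist)]
  linarith

end IsLift

/-- Expanding `C³` maps with uniform bounds on the first two derivatives. -/
structure UniformlyExpanding (μ Λ D : ℝ) (T : S1 → S1) : Prop where
  exists_isLift : ∃ (d : ℤ) (F G : ℝ → ℝ), IsLift T d F G
  le_mapDeriv : ∀ x, μ ≤ |mapDeriv T x|
  mapDeriv_le : ∀ x, |mapDeriv T x| ≤ Λ
  mapDeriv2_le : ∀ x, |mapDeriv2 T x| ≤ D

/-- The `L¹` norm of the weak derivative. -/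
noncomputable def variation (f : S1 → ℝ) : ℝ := l1Norm (weakDeriv f)

theorem l1Norm_nonneg (f : S1 → ℝ) : 0 ≤ l1Norm f := integral_nonneg fun _ => abs_nonneg _

theorem variation_nonneg (f : S1 → ℝ) : 0 ≤ variation f := l1Norm_nonneg _

namespace UniformlyExpanding

variable {μ Λ D : ℝ} {T : S1 → S1}

theorem memW11_transfer (h : UniformlyExpanding μ Λ D T) {f : S1 → ℝ} (hf : MemW11 f) :
    MemW11 (transfer T f) := by
  obtain ⟨d, F, G, hl⟩ := h.exists_isLift
  exact ⟨hl.integrable_transfer hf.1, _, hl.isWeakDeriv_transfer hf.1 hf.isWeakDeriv_weakDeriv⟩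

theorem l1Norm_transfer_le (h : UniformlyExpanding μ Λ D T) {f : S1 → ℝ} (hf : Integrable f) :
    l1Norm (transfer T f) ≤ l1Norm f := by
  obtain ⟨d, F, G, hl⟩ := h.exists_isLift
  exact hl.l1Norm_transfer_le hf

/-- The Lasota-Yorke inequality. -/
theorem variation_transfer_le (h : UniformlyExpanding μ Λ D T) (hμ : 0 < μ) {f : S1 → ℝ}
    (hf : MemW11 f) :
    variation (transfer T f) ≤ μ⁻¹ * variation f + D * μ⁻¹ ^ 2 * l1Norm f := by
  obtain ⟨d, F, G, hl⟩ := h.exists_isLift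
  have hw := hf.isWeakDeriv_weakDeriv
  have hi := hl.integrable_derivDensity hf.1 hw.1
  rw [variation, (hl.isWeakDeriv_transfer hf.1 hw).l1Norm_weakDeriv]
  refine (hl.l1Norm_transfer_le hi).trans ?_
  rw [variation, l1Norm, l1Norm, l1Norm, ← integral_const_mul, ← integral_const_mul,
    ← integral_add (hw.1.abs.const_mul _) (hf.1.abs.const_mul _)]
  refine integral_mono hi.abs ((hw.1.abs.const_mul _).add (hf.1.abs.const_mul _)) fun x => ?_
  have h1 : |mapDeriv T x|⁻¹ ≤ μ⁻¹ := inv_anti₀ hμ (h.le_mapDeriv x)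
  have h0 : 0 ≤ |mapDeriv T x|⁻¹ := inv_nonneg.2 (abs_nonneg _)
  have hD := h.mapDeriv2_le x
  change |derivDensity T f (weakDeriv f) x| ≤ μ⁻¹ * |weakDeriv f x| + D * μ⁻¹ ^ 2 * |f x|
  rw [derivDensity]
  refine (abs_sub _ _).trans ?_
  rw [abs_mul, abs_mul, abs_mul, abs_pow, abs_inv, mul_comm μ⁻¹, mul_comm _ |f x|]
  have := (abs_nonneg (mapDeriv2 T x)).trans hD
  gcongr

end UniformlyExpanding

/-! ### Sequential compositions: iterated Lasota-Yorke and growth of intervals -/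

section Sequences

variable {μ Λ D : ℝ} {T : ℕ → S1 → S1}

theorem seqTransfer_add (T : ℕ → S1 → S1) (j k m : ℕ) (f : S1 → ℝ) :
    seqTransfer T j (k + m) f = seqTransfer T (j + k) m (seqTransfer T j k f) := by
  induction m with
  | zero => rfl
  | succ m ih => rw [← add_assoc, seqTransfer, seqTransfer, ih, add_assoc]

theorem integrable_seqTransfer (hT : ∀ i, UniformlyExpanding μ Λ D (T i)) (j m : ℕ) {f : S1 → ℝ}
    (hf : Integrable f) : Integrable (seqTransfer T j m f) := by
  induction m with
  | zero => exact hf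
  | succ m ih =>
    obtain ⟨d, F, G, hl⟩ := (hT (j + m)).exists_isLift
    exact hl.integrable_transfer ih

theorem integral_seqTransfer (hT : ∀ i, UniformlyExpanding μ Λ D (T i)) (j m : ℕ) {f : S1 → ℝ}
    (hf : Integrable f) : ∫ x, seqTransfer T j m f x = ∫ x, f x := by
  induction m with
  | zero => rfl
  | succ m ih =>
    obtain ⟨d, F, G, hl⟩ := (hT (j + m)).exists_isLift
    exact (hl.integral_transfer (integrable_seqTransfer hT j m hf)).trans ih

theorem l1Norm_seqTransfer_le (hT : ∀ i, UniformlyExpanding μ Λ D (T i)) (j m : ℕ) {f : S1 → ℝ}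
    (hf : Integrable f) : l1Norm (seqTransfer T j m f) ≤ l1Norm f := by
  induction m with
  | zero => exact le_rfl
  | succ m ih =>
    exact ((hT (j + m)).l1Norm_transfer_le (integrable_seqTransfer hT j m hf)).trans ih

theorem memW11_seqTransfer (hT : ∀ i, UniformlyExpanding μ Λ D (T i)) (j m : ℕ) {f : S1 → ℝ}
    (hf : MemW11 f) : MemW11 (seqTransfer T j m f) := by
  induction m with
  | zero => exact hf
  | succ m ih => exact (hT (j + m)).memW11_transfer ih

theorem seqTransfer_ae_eq (hT : ∀ i, UniformlyExpanding μ Λ D (T i)) (j m : ℕ) {f g : S1 → ℝ}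
    (hf : Integrable f) (hfg : f =ᵐ[volume] g) :
    seqTransfer T j m f =ᵐ[volume] seqTransfer T j m g := by
  induction m with
  | zero => exact hfg
  | succ m ih =>
    obtain ⟨d, F, G, hl⟩ := (hT (j + m)).exists_isLift
    exact hl.transfer_ae_eq (integrable_seqTransfer hT j m hf) ih

theorem seqTransfer_sub (hT : ∀ i, UniformlyExpanding μ Λ D (T i)) (j m : ℕ) (f g : S1 → ℝ) :
    seqTransfer T j m (fun y => f y - g y) =
      fun x => seqTransfer T j m f x - seqTransfer T j m g x := by
  induction m with
  | zero => rfl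
  | succ m ih =>
    obtain ⟨d, F, G, hl⟩ := (hT (j + m)).exists_isLift
    rw [seqTransfer, ih]
    exact funext fun x => hl.transfer_sub _ _ x

theorem seqTransfer_nonneg (T : ℕ → S1 → S1) (j m : ℕ) {f : S1 → ℝ} (hf : ∀ x, 0 ≤ f x) :
    ∀ x, 0 ≤ seqTransfer T j m f x := by
  induction m with
  | zero => exact hf
  | succ m ih => exact transfer_nonneg _ ih

/-- The `L¹` norm does not increase, so the one-step errors sum to at most a geometric series of
ratio `μ⁻¹`. -/
theorem variation_seqTransfer_le (hμ : 1 < μ) (hD : 0 ≤ D)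
    (hT : ∀ i, UniformlyExpanding μ Λ D (T i)) (j m : ℕ) {f : S1 → ℝ} (hf : MemW11 f) :
    variation (seqTransfer T j m f) ≤
      μ⁻¹ ^ m * variation f + D * μ⁻¹ ^ 2 / (1 - μ⁻¹) * l1Norm f := by
  have ha0 : 0 < μ⁻¹ := inv_pos.2 (by linarith)
  have ha1 : 0 < 1 - μ⁻¹ := sub_pos.2 (inv_lt_one_of_one_lt₀ hμ)
  have hl := l1Norm_nonneg f
  induction m with
  | zero =>
    have : 0 ≤ D * μ⁻¹ ^ 2 / (1 - μ⁻¹) * l1Norm f := by positivity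
    simpa [seqTransfer] using this
  | succ m ih =>
    have h1 := (hT (j + m)).variation_transfer_le (by linarith) (memW11_seqTransfer hT j m hf)
    have h2 := l1Norm_seqTransfer_le hT j m hf.1
    have h3 : D * μ⁻¹ ^ 2 * l1Norm (seqTransfer T j m f) ≤ D * μ⁻¹ ^ 2 * l1Norm f := by gcongr
    have h4 := mul_le_mul_of_nonneg_left ih ha0.le
    have h5 : D * μ⁻¹ ^ 2 = (1 - μ⁻¹) * (D * μ⁻¹ ^ 2 / (1 - μ⁻¹)) :=
      (mul_div_cancel₀ _ ha1.ne').symm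
    rw [seqTransfer, pow_succ]
    generalize D * μ⁻¹ ^ 2 / (1 - μ⁻¹) = E at *
    rw [h5] at h3 h1
    nlinarith

/-- The image of an interval under an expanding map contains a longer interval, on which the
transfer operator preserves lower bounds up to the size of the derivative. -/
theorem UniformlyExpanding.exists_interval_le_transfer {T : S1 → S1}
    (hT : UniformlyExpanding μ Λ D T) (hμ : 0 < μ) {f : S1 → ℝ} (hf : ∀ x, 0 ≤ f x)
    {h a l : ℝ} (hl : 0 < l) (hfh : ∀ t ∈ Icc a (a + l), h ≤ f (t : S1)) :
    ∃ c, ∀ t ∈ Icc c (c + μ * l), h / Λ ≤ transfer T f (t : S1) := by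
  obtain ⟨d, F, G, hL⟩ := hT.exists_isLift
  obtain ⟨ξ, -, hξ⟩ := exists_deriv_eq_slope F (show a < a + l by linarith)
    hL.differentiable.continuous.continuousOn hL.differentiable.differentiableOn
  have h1 : μ * l ≤ |F (a + l) - F a| := by
    have h2 := hT.le_mapDeriv (ξ : S1)
    rw [hL.mapDeriv_coe, hξ, add_sub_cancel_left, abs_div, abs_of_pos hl, le_div_iff₀ hl] at h2
    exact h2
  refine ⟨min (F a) (F (a + l)), fun t ht => ?_⟩
  have h2 : t ∈ uIcc (F a) (F (a + l)) := by
    refine ⟨ht.1, ht.2.trans ?_⟩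
    have := max_sub_min_eq_abs (F a) (F (a + l))
    change _ ≤ max (F a) (F (a + l))
    linarith
  obtain ⟨s, hs, rfl⟩ := intermediate_value_uIcc hL.differentiable.continuous.continuousOn h2
  rw [uIcc_of_le (by linarith)] at hs
  refine le_trans ?_ (hL.le_transfer hf s)
  have h3 := hfh s hs
  have h4 := hT.mapDeriv_le (s : S1)
  have h6 := hf (s : S1)
  have h5 : 0 < |mapDeriv T (s : S1)| := hμ.trans_le (hT.le_mapDeriv _)
  gcongr

/-- The intervals live on the line, so their length may exceed 1 without any wrapping argument. -/
theorem exists_interval_le_seqTransfer (hμ : 0 < μ)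
    (hT : ∀ i, UniformlyExpanding μ Λ D (T i)) (j m : ℕ) {f : S1 → ℝ} (hf : ∀ x, 0 ≤ f x)
    {h a l : ℝ} (hl : 0 < l) (hfh : ∀ t ∈ Icc a (a + l), h ≤ f (t : S1)) :
    ∃ c, ∀ t ∈ Icc c (c + μ ^ m * l), h / Λ ^ m ≤ seqTransfer T j m f (t : S1) := by
  induction m with
  | zero => exact ⟨a, by simpa [seqTransfer] using hfh⟩
  | succ m ih =>
    obtain ⟨c, hc⟩ := ih
    obtain ⟨c', hc'⟩ := (hT (j + m)).exists_interval_le_transfer hμ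
      (seqTransfer_nonneg T j m hf) (h := h / Λ ^ m)
      (show 0 < μ ^ m * l by positivity) hc
    refine ⟨c', fun t ht => ?_⟩
    rw [pow_succ, ← div_div]
    exact hc' t (by rwa [← mul_assoc, ← pow_succ'])

theorem le_seqTransfer (hμ : 0 < μ)
    (hT : ∀ i, UniformlyExpanding μ Λ D (T i)) (j m : ℕ) {f : S1 → ℝ} (hf : ∀ x, 0 ≤ f x)
    {h a l : ℝ} (hl : 0 < l) (hfh : ∀ t ∈ Icc a (a + l), h ≤ f (t : S1))
    (hm : 1 ≤ μ ^ m * l) (x : S1) : h / Λ ^ m ≤ seqTransfer T j m f x := by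
  obtain ⟨c, hc⟩ := exists_interval_le_seqTransfer hμ hT j m hf hl hfh
  obtain ⟨t, ht, rfl⟩ := AddCircle.coe_image_Icc_eq (1 : ℝ) c ▸ mem_univ x
  exact hc t ⟨ht.1, by linarith [ht.2]⟩

end Sequences

/-- A function whose oscillation is small compared with its integral is at least half of its mean
on one of `N` equal subintervals. -/
theorem exists_subinterval_half_integral_le {p w : ℝ → ℝ} (hp : Continuous p)
    (hw : ∀ a b, IntervalIntegrable w volume a b) (hw0 : ∀ t, 0 ≤ w t)
    (hpw : ∀ a b, a ≤ b → |p b - p a| ≤ ∫ s in a..b, w s) {N : ℕ} (hN : 0 < N)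
    (hlt : 2 * ∫ t in (0 : ℝ)..1, w t < N * ∫ t in (0 : ℝ)..1, p t) :
    ∃ a : ℝ, ∀ t ∈ Icc a (a + 1 / N), (∫ t in (0 : ℝ)..1, p t) / 2 ≤ p t := by
  set I := ∫ t in (0 : ℝ)..1, p t with hI
  have hN' : (0 : ℝ) < N := by exact_mod_cast hN
  by_contra! hcon
  let e : ℕ → ℝ := fun i => i / N
  have he : ∀ i, e (i + 1) = e i + 1 / N := fun i => by
    simp only [e]; push_cast; ring
  have hle : ∀ i, e i ≤ e (i + 1) := fun i => by
    rw [he]; linarith [show 0 < 1 / (N : ℝ) by positivity]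
  -- If each interval contained a point with `p` below `I / 2`, the oscillation bound would give
  -- this estimate; its sum over `i` is `N * I ≤ N * I / 2 + ∫ w`, against `hlt`.
  have hstep : ∀ i, ∫ t in e i..e (i + 1), p t ≤
      1 / N * (I / 2 + ∫ t in e i..e (i + 1), w t) := by
    intro i
    obtain ⟨t, ht, htp⟩ := hcon (e i)
    rw [← he] at ht
    have hb : ∀ s ∈ Icc (e i) (e (i + 1)), p s ≤ I / 2 + ∫ t in e i..e (i + 1), w t := by
      intro s hs
      have h1 : |p s - p t| ≤ ∫ t in e i..e (i + 1), w t := by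
        rcases le_total s t with h | h
        · rw [abs_sub_comm]
          exact (hpw s t h).trans (intervalIntegral.integral_mono_interval hs.1 h ht.2
            (Eventually.of_forall hw0) (hw _ _))
        · exact (hpw t s h).trans (intervalIntegral.integral_mono_interval ht.1 h hs.2
            (Eventually.of_forall hw0) (hw _ _))
      linarith [le_abs_self (p s - p t)]
    have h2 := intervalIntegral.integral_mono_on (μ := volume) (hle i) (hp.intervalIntegrable _ _)
      (intervalIntegrable_const (c := I / 2 + ∫ t in e i..e (i + 1), w t)) hb
    rw [intervalIntegral.integral_const, he, add_sub_cancel_left, ← he, smul_eq_mul] at h2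
    exact h2
  have hsum := Finset.sum_le_sum fun i (_ : i ∈ Finset.range N) => hstep i
  rw [← Finset.mul_sum, Finset.sum_add_distrib, Finset.sum_const, Finset.card_range,
    intervalIntegral.sum_integral_adjacent_intervals (a := e) (f := p) (μ := volume)
      fun k _ => hp.intervalIntegrable _ _,
    intervalIntegral.sum_integral_adjacent_intervals (a := e) (f := w) (μ := volume)
      fun k _ => hw _ _] at hsum
  have e0 : e 0 = 0 := by simp [e]
  have e1 : e N = 1 := div_self hN'.ne'
  rw [e0, e1, ← hI, nsmul_eq_mul, div_mul_eq_mul_div, one_mul, le_div_iff₀ hN'] at hsum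
  linarith

/-! ### Contraction on functions of mean zero -/

section Contraction

variable {μ Λ D : ℝ} {T : ℕ → S1 → S1}

theorem le_seqTransfer_of_oscillation (hμ : 0 < μ)
    (hT : ∀ i, UniformlyExpanding μ Λ D (T i)) (j m : ℕ) {f w : S1 → ℝ} (hf : ∀ x, 0 ≤ f x)
    (hfc : Continuous f) (hw : Integrable w) (hw0 : ∀ x, 0 ≤ w x)
    (hfw : ∀ a b : ℝ, a ≤ b → |f (b : S1) - f (a : S1)| ≤ ∫ s in a..b, w (s : S1))
    {N : ℕ} (hN : 0 < N) (hlt : 2 * ∫ x, w x < N * ∫ x, f x) (hm : N ≤ μ ^ m) (x : S1) :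
    (∫ y, f y) / 2 / Λ ^ m ≤ seqTransfer T j m f x := by
  have hN' : (0 : ℝ) < N := by exact_mod_cast hN
  have h1 : ∀ g : S1 → ℝ, ∫ x, g x = ∫ t in (0 : ℝ)..1, g (t : S1) := fun g => by
    rw [integral_eq_intervalIntegral 0, zero_add]
  rw [h1 w, h1 f] at hlt
  rw [h1 f]
  obtain ⟨a, ha⟩ := exists_subinterval_half_integral_le
    (hfc.comp (AddCircle.continuous_mk' (1 : ℝ))) (integrable_intervalIntegrable hw)
    (fun t => hw0 _) hfw hN hlt
  refine le_seqTransfer hμ hT j m hf (show 0 < 1 / (N : ℝ) by positivity) ha ?_ x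
  rw [mul_one_div, le_div_iff₀ hN']
  linarith

/-- Loss of memory in `L¹` for functions of mean zero with controlled variation. -/
theorem l1Norm_seqTransfer_le_of_variation_le (hμ : 0 < μ) (hΛ : 0 < Λ)
    (hT : ∀ i, UniformlyExpanding μ Λ D (T i)) (j m : ℕ) {g : S1 → ℝ} (hg : MemW11 g)
    (hg0 : ∫ x, g x = 0) {K : ℝ} {N : ℕ} (hV : variation g ≤ K * l1Norm g)
    (hN : 0 < N) (hK : 4 * K < N) (hm : N ≤ μ ^ m) :
    l1Norm (seqTransfer T j m g) ≤ (1 - 1 / (2 * Λ ^ m)) * l1Norm g := by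
  rcases (l1Norm_nonneg g).eq_or_lt with h0 | hpos
  · rw [← h0, mul_zero, h0]
    exact l1Norm_seqTransfer_le hT j m hg.1
  obtain ⟨u, hu, hgu⟩ := hg.isWeakDeriv_weakDeriv.exists_isPrimitive hg.1
  have huc := hu.continuous
  have hui : Integrable u := integrable_of_continuous huc
  have hnorm : l1Norm g = ∫ x, |u x| := by
    refine integral_congr_ae ?_
    filter_upwards [hgu] with x hx
    rw [hx]
  have hu0 : ∫ x, u x = 0 := by rw [← hg0]; exact integral_congr_ae hgu.symm
  have osc : ∀ a b : ℝ, a ≤ b → |u (b : S1) - u (a : S1)| ≤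
      ∫ s in a..b, |weakDeriv g (s : S1)| := fun a b hab => by
    rw [hu.2]
    exact intervalIntegral.abs_integral_le_integral_abs hab
  -- The signs `σ = 1` and `σ = -1` treat the positive and negative parts together; mean zero gives
  -- each of them integral `l1Norm g / 2`.
  have key : ∀ σ : ℝ, |σ| = 1 → ∀ x, l1Norm g / 2 / 2 / Λ ^ m ≤
      seqTransfer T j m (fun y => max (σ * u y) 0) x := by
    intro σ hσ
    have hI : ∫ x, max (σ * u x) 0 = l1Norm g / 2 := by
      have h1 : ∀ x, max (σ * u x) 0 = (|u x| + σ * u x) / 2 := fun x => by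
        rw [← one_mul |u x|, ← hσ, ← abs_mul, max_def]
        split_ifs with h
        · rw [abs_of_nonpos h]; ring
        · rw [abs_of_pos (not_le.1 h)]; ring
      simp only [h1]
      rw [integral_div, integral_add hui.abs (hui.const_mul σ), integral_const_mul, hu0, hnorm]
      ring
    rw [← hI]
    refine le_seqTransfer_of_oscillation hμ hT j m (fun x => le_max_right _ _)
      ((huc.const_mul σ).max continuous_const) hg.isWeakDeriv_weakDeriv.1.abs
      (fun x => abs_nonneg _) (fun a b hab => ?_) hN ?_ hm
    · refine (abs_max_sub_max_le_abs _ _ _).trans ?_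
      rw [← mul_sub, abs_mul, hσ, one_mul]
      exact osc a b hab
    · rw [hI]
      change 2 * variation g < _
      nlinarith
  have kp := key 1 abs_one
  have kn := key (-1) (by simp)
  set up : S1 → ℝ := fun y => max (1 * u y) 0
  set un : S1 → ℝ := fun y => max (-1 * u y) 0
  have hup : Integrable up := integrable_of_continuous ((huc.const_mul 1).max continuous_const)
  have hun : Integrable un := integrable_of_continuous ((huc.const_mul (-1)).max continuous_const)
  have hsplit : u = fun y => up y - un y := funext fun y => by
    simp only [up, un, one_mul, neg_one_mul]
    rcases le_total (u y) 0 with h | h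
    · rw [max_eq_right h, max_eq_left (by linarith)]; ring
    · rw [max_eq_left h, max_eq_right (by linarith)]; ring
  have habs : ∀ y, |u y| = up y + un y := fun y => by
    simp only [up, un, one_mul, neg_one_mul]
    rcases le_total (u y) 0 with h | h
    · rw [max_eq_right h, max_eq_left (by linarith), abs_of_nonpos h]; ring
    · rw [max_eq_left h, max_eq_right (by linarith), abs_of_nonneg h]; ring
  set c := l1Norm g / 2 / 2 / Λ ^ m with hc
  have h1 : l1Norm (seqTransfer T j m g) = l1Norm (seqTransfer T j m u) := by
    refine integral_congr_ae ?_
    filter_upwards [seqTransfer_ae_eq hT j m hg.1 hgu] with x hx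
    rw [hx]
  have ip := integrable_seqTransfer hT j m hup
  have in' := integrable_seqTransfer hT j m hun
  -- Two numbers that are both at least `c` differ by at most their sum minus `2 * c`.
  have h2 : l1Norm (seqTransfer T j m u) ≤
      ∫ x, (seqTransfer T j m up x + seqTransfer T j m un x - 2 * c) := by
    refine integral_mono (integrable_seqTransfer hT j m hui).abs
      ((ip.add in').sub (integrable_const _)) fun x => ?_
    have hx : seqTransfer T j m u x = seqTransfer T j m up x - seqTransfer T j m un x := by
      rw [hsplit, seqTransfer_sub hT]
    change |seqTransfer T j m u x| ≤ seqTransfer T j m up x + seqTransfer T j m un x - 2 * c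
    rw [hx, abs_le]
    constructor <;> linarith [kp x, kn x]
  have h3 : ∫ x, (seqTransfer T j m up x + seqTransfer T j m un x - 2 * c) =
      l1Norm g - 2 * c := by
    have is : Integrable fun x => seqTransfer T j m up x + seqTransfer T j m un x := ip.add in'
    rw [integral_sub is (integrable_const _), integral_add ip in',
      integral_seqTransfer hT j m hup, integral_seqTransfer hT j m hun, ← integral_add hup hun,
      hnorm]
    simp only [habs]
    simp [measureReal_def]
  rw [h1]
  refine (h2.trans_eq h3).trans_eq ?_
  rw [hc]
  field_simp

end Contraction

/-- Write `V` for the variation and `L` for the `L¹` norm. If `V ≤ (4E + 1) L`, covering shrinks `L`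
by the factor `1 - η`, and `b` is so large that half of this gain pays for the Lasota-Yorke error `E
L`. Otherwise `V` dominates `L`, and the drop of `V` to at most `V / 4 + E L` suffices. -/
theorem exists_contraction {μ Λ D : ℝ} (hμ : 1 < μ) (hΛ : 1 ≤ Λ) (hD : 0 ≤ D) :
    ∃ (b θ C : ℝ) (k : ℕ), 1 ≤ b ∧ 0 < θ ∧ θ < 1 ∧ 1 ≤ C ∧ 1 ≤ k ∧
      ∀ T : ℕ → S1 → S1, (∀ i, UniformlyExpanding μ Λ D (T i)) → ∀ j : ℕ, ∀ g : S1 → ℝ,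
        MemW11 g → ∫ x, g x = 0 →
        variation (seqTransfer T j k g) + b * l1Norm (seqTransfer T j k g) ≤
            θ * (variation g + b * l1Norm g) ∧
          ∀ m, variation (seqTransfer T j m g) + b * l1Norm (seqTransfer T j m g) ≤
            C * (variation g + b * l1Norm g) := by
  have ha0 : 0 < μ⁻¹ := inv_pos.2 (by linarith)
  have ha1 : μ⁻¹ < 1 := inv_lt_one_of_one_lt₀ hμ
  have hLY := fun (T : ℕ → S1 → S1) (hT : ∀ i, UniformlyExpanding μ Λ D (T i)) (j m : ℕ)
    (g : S1 → ℝ) (hg : MemW11 g) => variation_seqTransfer_le hμ hD hT j m hg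
  have hE : 0 ≤ D * μ⁻¹ ^ 2 / (1 - μ⁻¹) := by
    have : 0 < 1 - μ⁻¹ := by linarith
    positivity
  generalize D * μ⁻¹ ^ 2 / (1 - μ⁻¹) = E at hLY hE
  obtain ⟨N, hN⟩ := exists_nat_gt (4 * (4 * E + 1))
  have hN0 : 0 < N := by
    have : (0 : ℝ) < N := by linarith
    exact_mod_cast this
  -- Here `k` is large enough for intervals of length `1 / N` to cover the circle and for the
  -- variation to be quartered.
  obtain ⟨k, hk1, hk2, hk3⟩ : ∃ k : ℕ, 1 ≤ k ∧ (N : ℝ) ≤ μ ^ k ∧ μ⁻¹ ^ k ≤ 1 / 4 :=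
    ((eventually_ge_atTop 1).and (((tendsto_pow_atTop_atTop_of_one_lt hμ).eventually_ge_atTop
      (N : ℝ)).and ((tendsto_pow_atTop_nhds_zero_of_lt_one ha0.le ha1).eventually_le_const
      (by norm_num)))).exists
  have hΛk : 1 ≤ Λ ^ k := one_le_pow₀ hΛ
  set η := 1 / (2 * Λ ^ k) with hη
  have hη0 : 0 < η := by positivity
  set b := 2 * E / η + 1 with hb
  have hbη : E ≤ b * (η / 2) := by
    have : b * (η / 2) = E + η / 2 := by rw [hb]; field_simp
    linarith
  have hb1 : 1 ≤ b := by
    have : 0 ≤ 2 * E / η := by positivity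
    linarith
  have hKb : 0 < (4 * E + 1) / (4 * b) := by positivity
  -- The bound `3 / 4` serves the `V` term in both regimes; the other two serve the term `b L` when
  -- `V` is controlled and when it is large, respectively.
  refine ⟨b, max (3 / 4) (max (1 - η / 2) (1 - (4 * E + 1) / (4 * b))), 1 + E, k, hb1, by simp,
    by simp [hη0, hKb]; norm_num, by linarith, hk1, fun T hT j g hg hg0 => ⟨?_, fun m => ?_⟩⟩
  · have hV := hLY T hT j k g hg
    have hV0 := variation_nonneg g
    have hL0 := l1Norm_nonneg g
    have hV' : μ⁻¹ ^ k * variation g ≤ 1 / 4 * variation g := by gcongr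
    set θ := max (3 / 4) (max (1 - η / 2) (1 - (4 * E + 1) / (4 * b))) with hθ
    have hθ1 : 3 / 4 ≤ θ := le_max_left _ _
    have hθ2 : 1 - η / 2 ≤ θ := (le_max_left _ _).trans (le_max_right _ _)
    have hθ3 : 1 - (4 * E + 1) / (4 * b) ≤ θ := (le_max_right _ _).trans (le_max_right _ _)
    have hθV := mul_le_mul_of_nonneg_right hθ1 hV0
    have hbL : 0 ≤ b * l1Norm g := by positivity
    rcases le_or_gt (variation g) ((4 * E + 1) * l1Norm g) with h | h
    · have h1 := l1Norm_seqTransfer_le_of_variation_le (by linarith) (by linarith) hT j k hg hg0 h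
        hN0 hN hk2
      have h2 := mul_le_mul_of_nonneg_left h1 (by linarith : 0 ≤ b)
      have h3 := mul_le_mul_of_nonneg_right hbη hL0
      have h4 := mul_le_mul_of_nonneg_right hθ2 hbL
      linarith
    · have h1 := l1Norm_seqTransfer_le hT j k hg.1
      have h2 := mul_le_mul_of_nonneg_left h1 (by linarith : 0 ≤ b)
      have h4 := mul_le_mul_of_nonneg_right hθ3 hbL
      have h5 : (1 - (4 * E + 1) / (4 * b)) * (b * l1Norm g) =
          b * l1Norm g - (4 * E + 1) / 4 * l1Norm g := by field_simp
      rw [h5] at h4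
      linarith
  · have hV := hLY T hT j m g hg
    have hV0 := variation_nonneg g
    have hL0 := l1Norm_nonneg g
    have h1 := l1Norm_seqTransfer_le hT j m hg.1
    have h2 := mul_le_mul_of_nonneg_left h1 (by linarith : 0 ≤ b)
    have h3 : μ⁻¹ ^ m * variation g ≤ 1 * variation g := by
      gcongr
      exact pow_le_one₀ ha0.le ha1.le
    have h4 : E * l1Norm g ≤ E * (b * l1Norm g) := by
      gcongr
      nlinarith
    nlinarith

/-! ### Exponential decay, uniformly over the ball -/

/-- Exponential loss of memory for compositions of uniformly expanding circle maps. -/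
theorem exists_exponential_decay {μ Λ D : ℝ} (hμ : 1 < μ) (hΛ : 1 ≤ Λ) (hD : 0 ≤ D) :
    ∃ C lam : ℝ, 1 ≤ C ∧ 0 < lam ∧
      ∀ T : ℕ → S1 → S1, (∀ i, UniformlyExpanding μ Λ D (T i)) →
        ∀ j m : ℕ, ∀ g : S1 → ℝ, MemW11 g → ∫ x, g x = 0 →
          w11Norm (seqTransfer T j m g) ≤ C * Real.exp (-lam * m) * w11Norm g := by
  obtain ⟨b, θ, C, k, hb, hθ0, hθ1, hC, hk, H⟩ := exists_contraction hμ hΛ hD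
  have hk0 : (0 : ℝ) < k := by exact_mod_cast hk
  set lam := -Real.log θ / k with hlam
  have hlam0 : 0 < lam := div_pos (neg_pos.2 (Real.log_neg hθ0 hθ1)) hk0
  have hexp : Real.exp (-lam * k) = θ := by
    have : -lam * k = Real.log θ := by rw [hlam]; field_simp
    rw [this, Real.exp_log hθ0]
  have hCθ : 1 ≤ C / θ := (one_le_div hθ0).2 (by linarith)
  refine ⟨C / θ * b, lam, one_le_mul_of_one_le_of_one_le hCθ hb, hlam0, fun T hT => ?_⟩
  -- Blocks of `k` steps are peeled off, which shifts the starting time; hence `j` and `g` vary in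
  -- the induction. A remainder `m < k` has `exp (-lam * m) ≥ θ`, whence the constant `C / θ`.
  have main : ∀ m j : ℕ, ∀ g : S1 → ℝ, MemW11 g → ∫ x, g x = 0 →
      variation (seqTransfer T j m g) + b * l1Norm (seqTransfer T j m g) ≤
        C / θ * Real.exp (-lam * m) * (variation g + b * l1Norm g) := by
    intro m
    induction m using Nat.strong_induction_on with
    | _ m ih =>
      intro j g hg hg0
      have hX : 0 ≤ variation g + b * l1Norm g := by
        have := variation_nonneg g
        have := l1Norm_nonneg g
        positivity
      rcases lt_or_ge m k with hmk | hmk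
      · refine ((H T hT j g hg hg0).2 m).trans (mul_le_mul_of_nonneg_right ?_ hX)
        have h1 : θ ≤ Real.exp (-lam * m) := by
          rw [← hexp, Real.exp_le_exp]
          have : (m : ℝ) ≤ k := by exact_mod_cast hmk.le
          nlinarith
        rw [div_mul_eq_mul_div, le_div_iff₀ hθ0]
        gcongr
      · obtain ⟨l, rfl⟩ := Nat.exists_eq_add_of_le hmk
        rw [seqTransfer_add]
        refine (ih l (by omega) (j + k) _ (memW11_seqTransfer hT j k hg)
          ((integral_seqTransfer hT j k hg.1).trans hg0)).trans ?_
        have h1 : Real.exp (-lam * ((k + l : ℕ) : ℝ)) = θ * Real.exp (-lam * l) := by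
          rw [← hexp, ← Real.exp_add]
          push_cast
          ring_nf
        rw [h1]
        calc _ ≤ C / θ * Real.exp (-lam * l) * (θ * (variation g + b * l1Norm g)) := by
              gcongr
              exact (H T hT j g hg hg0).1
          _ = _ := by ring
  intro j m g hg hg0
  have h1 := main m j g hg hg0
  have h2 := l1Norm_nonneg (seqTransfer T j m g)
  have h3 := variation_nonneg g
  have h4 : variation g + b * l1Norm g ≤ b * w11Norm g := by
    rw [w11Norm]
    change _ ≤ b * (l1Norm g + variation g)
    nlinarith
  calc w11Norm (seqTransfer T j m g)
      = l1Norm (seqTransfer T j m g) + variation (seqTransfer T j m g) := rfl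
    _ ≤ variation (seqTransfer T j m g) + b * l1Norm (seqTransfer T j m g) := by nlinarith
    _ ≤ C / θ * Real.exp (-lam * m) * (variation g + b * l1Norm g) := h1
    _ ≤ C / θ * Real.exp (-lam * m) * (b * w11Norm g) := by gcongr
    _ = C / θ * b * Real.exp (-lam * m) * w11Norm g := by ring

/-- The triangle inequality at each point. Continuity of the derivatives guarantees that the suprema
in `c2Dist` are true upper bounds, not the default value of an unbounded supremum. -/
theorem uniformlyExpanding_of_mem_expandingBall {n : ℕ} {T₀ T : S1 → S1} {δ : ℝ}
    (hT₀ : IsExpandingC3 T₀ n) (hT : T ∈ expandingBall n T₀ δ) :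
    UniformlyExpanding (minExpansion T₀ - δ) (supNorm (mapDeriv T₀) + δ)
      (supNorm (mapDeriv2 T₀) + δ) T := by
  obtain ⟨hE, hd⟩ := hT
  have hc1 := hE.smooth.continuous_mapDeriv
  have hc2 := hE.smooth.continuous_mapDeriv2
  have hc1' := hT₀.smooth.continuous_mapDeriv
  have hc2' := hT₀.smooth.continuous_mapDeriv2
  have h1 : ∀ x, |mapDeriv T x - mapDeriv T₀ x| ≤ δ := fun x =>
    (abs_le_supNorm (hc1.sub hc1') x).trans
      (((le_max_left _ _).trans (le_max_right _ _)).trans hd)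
  have h2 : ∀ x, |mapDeriv2 T x - mapDeriv2 T₀ x| ≤ δ := fun x =>
    (abs_le_supNorm (hc2.sub hc2') x).trans
      (((le_max_right _ _).trans (le_max_right _ _)).trans hd)
  refine ⟨?_, fun x => ?_, fun x => ?_, fun x => ?_⟩
  · obtain ⟨d, F, G, h, -⟩ := hE.exists_isLift
    exact ⟨d, F, G, h⟩
  · have := abs_sub_abs_le_abs_sub (mapDeriv T₀ x) (mapDeriv T x)
    rw [abs_sub_comm] at this
    linarith [h1 x, minExpansion_le T₀ x]
  · linarith [abs_sub_abs_le_abs_sub (mapDeriv T x) (mapDeriv T₀ x), h1 x,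
      abs_le_supNorm hc1' x]
  · linarith [abs_sub_abs_le_abs_sub (mapDeriv2 T x) (mapDeriv2 T₀ x), h2 x,
      abs_le_supNorm hc2' x]

end CircleMaps

open CircleMaps in
theorem lemma5p1 (n : ℕ) (hn : 2 ≤ n) (T₀ : S1 → S1) (hT₀ : IsExpandingC3 T₀ n)
    (lam1 B : ℝ) (hlam0 : 0 < lam1) (hlam1 : lam1 < 1) (hB : 0 ≤ B)
    (hLYw : ∀ f, MemW11 f → l1Norm (transfer T₀ f) ≤ l1Norm f)
    (hLYs : ∀ f, MemW11 f → w11Norm (transfer T₀ f) ≤ lam1 * w11Norm f + B * l1Norm f)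
    (M : ℕ) (hM : lam1 ^ M ≤ 1 / (10 * (B / (1 - lam1) + 1)))
    (hMv : ∀ v, MemW11 v → ∫ x, v x = 0 →
      l1Norm ((transfer T₀)^[M] v) ≤ 1 / (10 * B) * w11Norm v)
    (δ : ℝ) (hδ0 : 0 < δ) (hδ1 : δ < minExpansion T₀ - 1)
    (hδ : mixedConst n T₀ * δ ≤
      7 * (1 - lam1) ^ 2 / (10 * M * B * (1 / (1 - lam1) + B))) :
    ∃ C lam : ℝ, 1 ≤ C ∧ 0 < lam ∧
      ∀ T : ℕ → S1 → S1, (∀ i, T i ∈ expandingBall n T₀ δ) →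
        ∀ j m : ℕ, ∀ g : S1 → ℝ, MemW11 g → ∫ x, g x = 0 →
          MemW11 (seqTransfer T j m g) ∧
            w11Norm (seqTransfer T j m g) ≤ C * Real.exp (-lam * m) * w11Norm g := by
  -- All bounds depend on `T₀` and `δ` only, so `C` and `lam` can be fixed before the sequence is
  -- chosen.
  have hμ : 1 < minExpansion T₀ - δ := by linarith
  have hΛ : 1 ≤ supNorm (mapDeriv T₀) + δ := by
    have h1 := minExpansion_le T₀ 0
    have h2 := abs_le_supNorm hT₀.smooth.continuous_mapDeriv 0
    linarith
  have hD : 0 ≤ supNorm (mapDeriv2 T₀) + δ := by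
    have := (abs_nonneg _).trans (abs_le_supNorm hT₀.smooth.continuous_mapDeriv2 0)
    linarith
  obtain ⟨C, lam, hC, hlam, H⟩ := exists_exponential_decay hμ hΛ hD
  refine ⟨C, lam, hC, hlam, fun T hT j m g hg hg0 => ?_⟩
  have hU := fun i => uniformlyExpanding_of_mem_expandingBall hT₀ (hT i)
  exact ⟨memW11_seqTransfer hU j m hg, H T hU j m g hg hg0⟩
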